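/- \textbf{Setting.} Let $G\subset\mathbb C\cup\{\infty\}$ be an unbounded multiply connected region of connectivity $m$ with $0,\infty\in G$, bounded by $\Gamma=\partial G=\Gamma_1\cup\dots\cup\Gamma_m$, where the $\Gamma_k$ are pairwise disjoint simple closed curves, clockwise oriented, and the complement $G^-$ of $G\cup\Gamma$ in $\mathbb C\cup\{\infty\}$ consists of $m$ bounded simply connected regions $G_1,\dots,G_m$ with $\partial G_k=\Gamma_k$. Each $\Gamma_k$ is parametrized (clockwise) by a $2\pi$-periodic twice continuously differentiable function $\eta_k$ with $\dot\eta_k\neq0$. Let $J$ be the disjoint union of $m$ copies $J_1,\dots,J_m$ of $[0,2\pi]$, and let $\eta$ on $J$ be given by $\eta=\eta_k$ on $J_k$. Let $A$ be a nowhere vanishing, continuously differentiable complex function on $\Gamma$, given in parametric form $A(t)$, $t\in J$ ($2\pi$-periodic and $C^1$ on each $J_k$). Let $H$ be the space of real functions on $J$ that are Hölder continuous and $2\pi$-periodic on each $J_k$. Define $$M(s,t)+\mathrm i N(s,t)=\frac1\pi\,\frac{A(s)}{A(t)}\,\frac{\dot\eta(t)}{\eta(t)-\eta(s)},$$ where $N$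 is continuous with diagonal values $N(t,t)=\frac1\pi\operatorname{Im}\bigl(\frac12\frac{\ddot\eta(t)}{\dot\eta(t)}-\frac{\dot A(t)}{A(t)}\bigr)$, and for $\phi\in H$ put $$\mathbf N\phi(s)=\int_J N(s,t)\phi(t)\,dt,\qquad \mathbf M\phi(s)=\mathrm{p.v.}\!\int_J M(s,t)\phi(t)\,dt,$$ the latter being a Cauchy principal value. Let $S^-$ be the space of all $\phi\in H$ for which there is a function $g$, analytic in $G^-$ and continuous on $G^-\cup\Gamma$, with $\phi=Ag^-$, where $g^-(s)=g(\eta(s))$. \textbf{Theorem.} Let $\gamma\in H$ be given, let $\mu\in H$ be a solution of the integral equation $$\mu-\mathbf N\mu=-\mathbf M\gamma ,$$ and let $$\Phi(z)=\frac1{2\pi\mathrm i}\int_\Gamma\frac{\gamma+\mathrm i\mu}{A}\,\frac{d\eta}{\eta-z},\qquad z\notin\Gamma .$$ Then the principal values $\mathbf M\gamma$ and $\mathbf M\mu$ exist, and $f:=\Phi$ in $G$ is analytic in $G$ with $f(\infty)=0$, extends continuously to $G\cup\Gamma$, and its boundary values $f^+$ satisfy $$Af^+=\gamma+h+\mathrm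 i\mu ,\qquad\text{where } h=\tfrac12\bigl[\mathbf M\mu-(\mathbf I-\mathbf N)\gamma\bigr]$$ is a real function that belongs to $S^-$ (in particular $h\in H$). -/

import Mathlib

noncomputable section

namespace GenNeumann

open Set Filter Topology MeasureTheory

/-- The winding number about `z` of a closed curve given by a `2π`-periodic parametrization `c`. -/
def windingNumber (c : ℝ → ℂ) (z : ℂ) : ℂ :=
  (2 * (Real.pi : ℂ) * Complex.I)⁻¹ * ∫ t in (0 : ℝ)..(2 * Real.pi), deriv c t / (c t - z)

/-- An unbounded multiply connected region `G ∋ 0, ∞` of connectivity `m` in the extended plane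
(the point `∞` is not represented, it belongs to `G` in the sense that `Gᶜ` is bounded), with the
parametrizations `η k` of the boundary curves and the bounded components `hole k` of
the complement of the closure of `G`. -/
structure UnboundedRegion (m : ℕ) where
  /-- the region, without its point at infinity -/
  G : Set ℂ
  /-- the bounded simply connected regions inside the boundary curves -/
  hole : Fin m → Set ℂ
  /-- the parametrizations of the boundary curves -/
  η : Fin m → ℝ → ℂ
  contDiff_η : ∀ k, ContDiff ℝ 2 (η k)
  periodic_η : ∀ k, Function.Periodic (η k) (2 * Real.pi)
  deriv_η_ne_zero : ∀ k s, deriv (η k) s ≠ 0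
  /-- every boundary curve is simple -/
  injOn_η : ∀ k, InjOn (η k) (Ico 0 (2 * Real.pi))
  /-- the boundary curves do not intersect each other -/
  disjoint_curves : ∀ j k, j ≠ k → Disjoint (range (η j)) (range (η k))
  isOpen_G : IsOpen G
  isConnected_G : IsConnected G
  isBounded_compl_G : Bornology.IsBounded Gᶜ
  zero_mem_G : (0 : ℂ) ∈ G
  frontier_G : frontier G = ⋃ k, range (η k)
  isOpen_hole : ∀ k, IsOpen (hole k)
  isBounded_hole : ∀ k, Bornology.IsBounded (hole k)
  simplyConnected_hole : ∀ k, IsSimplyConnected (hole k)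
  disjoint_holes : ∀ j k, j ≠ k → Disjoint (hole j) (hole k)
  frontier_hole : ∀ k, frontier (hole k) = range (η k)
  compl_eq_holes : (G ∪ ⋃ k, range (η k))ᶜ = ⋃ k, hole k
  /-- every boundary curve is clockwise oriented -/
  clockwise : ∀ k, ∀ z ∈ hole k, windingNumber (η k) z = -1

/-- Real functions on the total parameter domain (one function of a real variable for each
boundary curve) that are `2π`-periodic and Hölder continuous on each boundary curve. -/
def H (m : ℕ) : Set (Fin m → ℝ → ℝ) :=
  {φ | ∀ k, Function.Periodic (φ k) (2 * Real.pi) ∧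
    ∃ C α : NNReal, 0 < α ∧ α ≤ 1 ∧ HolderWith C α (φ k)}

/-- A nonvanishing continuously differentiable complex function on the boundary, in
parametric form. -/
structure IsCoefficient {m : ℕ} (A : Fin m → ℝ → ℂ) : Prop where
  contDiff : ∀ k, ContDiff ℝ 1 (A k)
  periodic : ∀ k, Function.Periodic (A k) (2 * Real.pi)
  ne_zero : ∀ k s, A k s ≠ 0

namespace UnboundedRegion

variable {m : ℕ} (R : UnboundedRegion m)

/-- The whole boundary. -/
def Γ : Set ℂ := ⋃ k, range (R.η k)

/-- The complement of `G ∪ Γ` (in the extended plane, whose point at infinity lies in `G`). -/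
def GMinus : Set ℂ := (R.G ∪ R.Γ)ᶜ

/-- The Cauchy type integral of `(γ + iμ) / A` over the boundary. -/
def cauchyIntegral (A : Fin m → ℝ → ℂ) (γ μ : Fin m → ℝ → ℝ) (z : ℂ) : ℂ :=
  (2 * (Real.pi : ℂ) * Complex.I)⁻¹ * ∑ k, ∫ t in (0 : ℝ)..(2 * Real.pi),
    ((γ k t : ℂ) + Complex.I * (μ k t : ℂ)) / A k t * (deriv (R.η k) t / (R.η k t - z))

/-- The complex kernel `(1/π) (A(s)/A(t)) η'(t)/(η(t) - η(s))`, where `s` is a parameter on the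
curve `k` and `t` is a parameter on the curve `j`; it is meaningful for `η(t) ≠ η(s)`. -/
def kernel (A : Fin m → ℝ → ℂ) (k : Fin m) (s : ℝ) (j : Fin m) (t : ℝ) : ℂ :=
  (1 / (Real.pi : ℂ)) * (A k s / A j t) * (deriv (R.η j) t / (R.η j t - R.η k s))

open Classical in
/-- The generalized Neumann kernel `N`, with its continuous value on the diagonal
(the boundary points with parameters `s` and `t` coincide). -/
def kernelN (A : Fin m → ℝ → ℂ) (k : Fin m) (s : ℝ) (j : Fin m) (t : ℝ) : ℝ :=
  if R.η j t = R.η k s then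
    (1 / Real.pi) *
      ((1 / 2 : ℂ) * (deriv (deriv (R.η j)) t / deriv (R.η j) t) - deriv (A j) t / A j t).im
  else (R.kernel A k s j t).im

/-- The kernel `M`, off the diagonal. -/
def kernelM (A : Fin m → ℝ → ℂ) (k : Fin m) (s : ℝ) (j : Fin m) (t : ℝ) : ℝ :=
  (R.kernel A k s j t).re

/-- The integral operator with the generalized Neumann kernel. -/
def opN (A : Fin m → ℝ → ℂ) (φ : Fin m → ℝ → ℝ) (k : Fin m) (s : ℝ) : ℝ :=
  ∑ j, ∫ t in (0 : ℝ)..(2 * Real.pi), R.kernelN A k s j t * φ j t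

/-- The integral of `M(s, ·) φ` over the boundary parameters outside the `ε`-neighbourhood of the
singularity: on the curve `k` that carries the parameter `s`, one full period without
`(s - ε, s + ε)` is `[s + ε, s + 2π - ε]`. -/
def truncM (A : Fin m → ℝ → ℂ) (φ : Fin m → ℝ → ℝ) (k : Fin m) (s ε : ℝ) : ℝ :=
  ∑ j, if j = k then ∫ t in (s + ε)..(s + 2 * Real.pi - ε), R.kernelM A k s j t * φ j t
    else ∫ t in (0 : ℝ)..(2 * Real.pi), R.kernelM A k s j t * φ j t

/-- The singular integral operator with kernel `M`, as a Cauchy principal value. -/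
def opM (A : Fin m → ℝ → ℂ) (φ : Fin m → ℝ → ℝ) (k : Fin m) (s : ℝ) : ℝ :=
  limUnder (𝓝[>] (0 : ℝ)) (fun ε => R.truncM A φ k s ε)

/-- The space `S⁻` of the real functions `φ ∈ H` with `φ = A g⁻` for a function `g` that is
analytic in `G⁻` and continuous on `G⁻ ∪ Γ` (so `g⁻` is the restriction of `g` to `Γ`). -/
def SMinus (A : Fin m → ℝ → ℂ) : Set (Fin m → ℝ → ℝ) :=
  {φ | φ ∈ H m ∧ ∃ g : ℂ → ℂ, AnalyticOnNhd ℂ g R.GMinus ∧ ContinuousOn g (R.GMinus ∪ R.Γ) ∧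
    ∀ k s, (φ k s : ℂ) = A k s * g (R.η k s)}

/-- The function `[M μ - (I - N) γ] / 2`. -/
def hFun (A : Fin m → ℝ → ℂ) (γ μ : Fin m → ℝ → ℝ) (k : Fin m) (s : ℝ) : ℝ :=
  (R.opM A μ k s - (γ k s - R.opN A γ k s)) / 2

end UnboundedRegion

end GenNeumann

end

/-! The theorem is the Plemelj jump relation for Φ, read through the real and imaginary parts of one
complex singular integral. Put ψ = (γ + iμ)/A. On the curve k, let B(ψ) be the integral of (ψ(t) -
ψ(s)) η'(t)/(η(t) - η(s)) over that curve plus the ordinary Cauchy integrals over the other curves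
(`boundaryCauchy`). The constant density contributes only a winding number, equal to 0 on G and,
after division by 2πi, to -1 in the hole. Hence Φ has the boundary values B(ψ)/(2πi) from G and
B(ψ)/(2πi) - ψ from the holes (`tendsto_cauchy_G`, `tendsto_cauchy_GMinus`).

The principal value of the bare Cauchy kernel is -πi, so for real φ the number (1/π)(A B(φ/A) - πi
φ) has imaginary part Nφ and real part Mφ (`opN_eq`, `tendsto_truncM`). Substituting this for γ and
μ in A f⁺ = A B(ψ)/(2πi), the real part is γ + h identically, and the imaginary part is (μ + Nμ -
Mγ)/2, which equals μ exactly by the integral equation (`boundary_value_eq`). The jump then gives h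
= A f⁺ - Aψ = A Φ⁻, where Φ⁻ extends Φ from the holes; this places h in S⁻.

The analytic work is in uniform limits: `bddHolder_regCauchy` gives Hölder continuity of the
regularized integral, `exists_approach_bound` compares Φ near a curve with its direct value at a
nearest boundary point, and `tendsto_winding_integral_normal` evaluates the principal value by
approaching along the normal. -/

noncomputable section

namespace GenNeumann

open Set Filter Topology MeasureTheory Real

/-! ### Bounded Hölder continuous functions -/

/-- Bounded functions on the real line that are Hölder continuous with exponent `α`. -/
def BddHolder (α : ℝ) (f : ℝ → ℂ) : Prop :=
  ∃ C, 0 ≤ C ∧ (∀ s, ‖f s‖ ≤ C) ∧ ∀ s t, ‖f s - f t‖ ≤ C * |s - t| ^ α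

namespace BddHolder

variable {α β : ℝ} {f g : ℝ → ℂ}

/-- Boundedness is what allows the exponent to be lowered globally: for distances above 1 the
estimate comes from the supremum, whence the factor 2. -/
lemma mono (hf : BddHolder α f) (hβ : 0 ≤ β) (h : β ≤ α) : BddHolder β f := by
  obtain ⟨C, hC, hb, hl⟩ := hf
  refine ⟨2 * C, by linarith, fun s => (hb s).trans (by linarith), fun s t => ?_⟩
  rcases le_total |s - t| 1 with h1 | h1
  · rcases eq_or_ne |s - t| 0 with h0 | h0
    · have : s = t := by simpa [sub_eq_zero] using h0
      subst this
      simp only [sub_self, norm_zero]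
      positivity
    · have := rpow_le_rpow_of_exponent_ge (lt_of_le_of_ne (abs_nonneg _) h0.symm) h1 h
      calc _ ≤ C * |s - t| ^ α := hl s t
        _ ≤ C * |s - t| ^ β := by gcongr
        _ ≤ _ := by gcongr; linarith
  · calc _ ≤ ‖f s‖ + ‖f t‖ := norm_sub_le _ _
      _ ≤ 2 * C * 1 := by linarith [hb s, hb t]
      _ ≤ _ := by gcongr; exact one_le_rpow h1 hβ

lemma add (hf : BddHolder α f) (hg : BddHolder α g) : BddHolder α (fun s => f s + g s) := by
  obtain ⟨C, hC, hb, hl⟩ := hf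
  obtain ⟨D, hD, hb', hl'⟩ := hg
  refine ⟨C + D, by linarith, fun s => (norm_add_le _ _).trans (add_le_add (hb s) (hb' s)),
    fun s t => ?_⟩
  calc ‖f s + g s - (f t + g t)‖ = ‖(f s - f t) + (g s - g t)‖ := by congr 1; ring
    _ ≤ _ := (norm_add_le _ _).trans (add_le_add (hl s t) (hl' s t))
    _ = _ := by ring

lemma mul (hf : BddHolder α f) (hg : BddHolder α g) : BddHolder α (fun s => f s * g s) := by
  obtain ⟨C, hC, hb, hl⟩ := hf
  obtain ⟨D, hD, hb', hl'⟩ := hg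
  refine ⟨2 * (C * D), by positivity, fun s => ?_, fun s t => ?_⟩
  · rw [norm_mul]
    have := mul_le_mul (hb s) (hb' s) (norm_nonneg _) hC
    nlinarith [mul_nonneg hC hD]
  · calc ‖f s * g s - f t * g t‖ = ‖(f s - f t) * g s + f t * (g s - g t)‖ := by congr 1; ring
      _ ≤ ‖f s - f t‖ * ‖g s‖ + ‖f t‖ * ‖g s - g t‖ := by
        refine (norm_add_le _ _).trans ?_
        rw [norm_mul, norm_mul]
      _ ≤ (C * |s - t| ^ α) * D + C * (D * |s - t| ^ α) := by
        gcongr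
        exacts [hl s t, hb' s, hb t, hl' s t]
      _ = _ := by ring

lemma const (c : ℂ) : BddHolder α (fun _ => c) :=
  ⟨‖c‖, norm_nonneg _, fun _ => le_rfl, fun s t => by simp only [sub_self, norm_zero]; positivity⟩

lemma sub (hf : BddHolder α f) (hg : BddHolder α g) : BddHolder α (fun s => f s - g s) := by
  simpa [sub_eq_add_neg] using hf.add ((const (-1)).mul hg)

lemma sum {ι : Type*} (S : Finset ι) {F : ι → ℝ → ℂ} (hF : ∀ i ∈ S, BddHolder α (F i)) :
    BddHolder α (fun s => ∑ i ∈ S, F i s) := by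
  classical
  induction S using Finset.induction_on with
  | empty => simpa using const 0
  | insert a S ha ih =>
    simp only [Finset.sum_insert ha]
    exact (hF a (Finset.mem_insert_self _ _)).add
      (ih fun i hi => hF i (Finset.mem_insert_of_mem hi))

lemma continuous (hf : BddHolder α f) (hα : 0 < α) : Continuous f := by
  obtain ⟨C, hC, -, hl⟩ := hf
  rw [continuous_iff_continuousAt]
  intro s
  rw [ContinuousAt, tendsto_iff_norm_sub_tendsto_zero]
  refine squeeze_zero (fun _ => norm_nonneg _) (fun t => hl t s) ?_
  have : Continuous fun t : ℝ => C * |t - s| ^ α :=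
    continuous_const.mul ((continuous_abs.comp (continuous_id.sub continuous_const)).rpow_const
      fun _ => Or.inr hα.le)
  simpa [zero_rpow hα.ne'] using this.tendsto s

end BddHolder

lemma exists_bound_of_periodic {E : Type*} [NormedAddCommGroup E] {f : ℝ → E} (hf : Continuous f)
    (hp : Function.Periodic f (2 * π)) : ∃ C, 0 < C ∧ ∀ s, ‖f s‖ ≤ C := by
  obtain ⟨C, hC⟩ := isCompact_Icc.exists_bound_of_continuousOn (s := Icc 0 (2 * π)) hf.continuousOn
  refine ⟨max C 1, by positivity, fun s => ?_⟩
  obtain ⟨y, hy, h⟩ := hp.exists_mem_Ico₀ two_pi_pos s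
  rw [h]
  exact (hC y ⟨hy.1, hy.2.le⟩).trans (le_max_left _ _)

lemma periodic_deriv {f : ℝ → ℂ} {T : ℝ} (hp : Function.Periodic f T) :
    Function.Periodic (deriv f) T := fun s => by
  rw [← deriv_comp_add_const]
  congr 1
  exact funext hp

lemma exists_lipschitz_of_periodic {f : ℝ → ℂ} (hf : ContDiff ℝ 1 f)
    (hp : Function.Periodic f (2 * π)) : ∃ C, 0 < C ∧ (∀ s, ‖deriv f s‖ ≤ C) ∧
      ∀ s t, ‖f s - f t‖ ≤ C * |s - t| := by
  obtain ⟨C, hC, hb⟩ := exists_bound_of_periodic (hf.continuous_deriv le_rfl) (periodic_deriv hp)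
  refine ⟨C, hC, hb, fun s t => ?_⟩
  exact convex_univ.norm_image_sub_le_of_norm_deriv_le
    (fun x _ => hf.differentiable (by simp) x) (fun x _ => hb x) (mem_univ t) (mem_univ s)

lemma BddHolder.of_contDiff {f : ℝ → ℂ} (hf : ContDiff ℝ 1 f)
    (hp : Function.Periodic f (2 * π)) : BddHolder 1 f := by
  obtain ⟨C, hC, -, hl⟩ := exists_lipschitz_of_periodic hf hp
  obtain ⟨D, hD, hb⟩ := exists_bound_of_periodic hf.continuous hp
  refine ⟨C + D, by positivity, fun s => (hb s).trans (by linarith), fun s t => ?_⟩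
  rw [rpow_one]
  exact (hl s t).trans (by gcongr; linarith)

lemma BddHolder.ofReal {φ : ℝ → ℝ} {C α : NNReal} (hα : 0 < α) (h : HolderWith C α φ)
    (hp : Function.Periodic φ (2 * π)) : BddHolder α (fun s => (φ s : ℂ)) := by
  obtain ⟨D, hD, hb⟩ := exists_bound_of_periodic (h.continuous hα) hp
  refine ⟨C + D, by positivity, fun s => ?_, fun s t => ?_⟩
  · rw [Complex.norm_real]
    exact (hb s).trans (by simp)
  · rw [← Complex.ofReal_sub, Complex.norm_real]
    refine (h.dist_le s t).trans ?_
    rw [Real.dist_eq]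
    gcongr
    linarith

lemma BddHolder.exists_holderWith {φ : ℝ → ℝ} {α : ℝ} (hα : 0 ≤ α)
    (h : BddHolder α (fun s => (φ s : ℂ))) : ∃ C, HolderWith C α.toNNReal φ := by
  obtain ⟨C, hC, -, hl⟩ := h
  refine ⟨C.toNNReal, fun s t => ?_⟩
  have h1 := hl s t
  rw [← Complex.ofReal_sub, Complex.norm_real] at h1
  rw [edist_dist, edist_dist, Real.dist_eq, Real.dist_eq, Real.coe_toNNReal _ hα,
    ENNReal.ofReal_rpow_of_nonneg (abs_nonneg _) hα]
  rw [show (C.toNNReal : ENNReal) = ENNReal.ofReal C from rfl, ← ENNReal.ofReal_mul hC]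
  exact ENNReal.ofReal_le_ofReal h1

/-! ### Regular closed curves -/

/-- A twice continuously differentiable parametrization of a simple closed curve. -/
structure IsRegularCurve (η : ℝ → ℂ) : Prop where
  contDiff : ContDiff ℝ 2 η
  periodic : Function.Periodic η (2 * π)
  deriv_ne_zero : ∀ s, deriv η s ≠ 0
  injOn : InjOn η (Ico 0 (2 * π))

/-- The Cauchy kernel of a curve, as a function of a parameter and of the distance from it. -/
def chordKernel (η : ℝ → ℂ) (s u : ℝ) : ℂ := deriv η (s + u) / (η (s + u) - η s)

namespace IsRegularCurve

variable {η : ℝ → ℂ} (hη : IsRegularCurve η)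
include hη

lemma differentiable : Differentiable ℝ η := hη.contDiff.differentiable (by simp)

lemma contDiff_deriv : ContDiff ℝ 1 (deriv η) := by
  have := hη.contDiff
  rw [show (2 : WithTop ℕ∞) = 1 + 1 by norm_num, contDiff_succ_iff_deriv] at this
  exact this.2.2

lemma continuous_deriv : Continuous (deriv η) := hη.contDiff_deriv.continuous

lemma continuous : Continuous η := hη.contDiff.continuous

lemma eq_iff {s t : ℝ} : η s = η t ↔ ∃ n : ℤ, s = t + n * (2 * π) := by
  constructor
  · intro h
    have e : ∀ x, η (toIcoMod two_pi_pos 0 x) = η x := fun x => by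
      rw [toIcoMod, hη.periodic.sub_zsmul_eq]
    have hm : ∀ x, toIcoMod two_pi_pos 0 x ∈ Ico 0 (2 * π) := fun x => by
      simpa using toIcoMod_mem_Ico two_pi_pos 0 x
    have h1 := hη.injOn (hm s) (hm t) (by rw [e, e, h])
    rw [toIcoMod, toIcoMod] at h1
    refine ⟨toIcoDiv two_pi_pos 0 s - toIcoDiv two_pi_pos 0 t, ?_⟩
    simp only [zsmul_eq_mul] at h1
    push_cast
    linarith
  · rintro ⟨n, rfl⟩
    exact hη.periodic.int_mul n t

lemma sub_ne_zero {s u : ℝ} (hu : |u| ≤ π) (h0 : u ≠ 0) : η (s + u) - η s ≠ 0 := by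
  rw [_root_.sub_ne_zero]
  intro h
  obtain ⟨n, hn⟩ := hη.eq_iff.1 h
  have hn' : u = n * (2 * π) := by linarith
  have hn0 : n ≠ 0 := by rintro rfl; simp at hn'; exact h0 hn'
  have : (1 : ℝ) ≤ |(n : ℝ)| := by exact_mod_cast Int.one_le_abs hn0
  rw [hn', abs_mul, abs_of_pos two_pi_pos] at hu
  nlinarith [pi_pos]

/-- Mean value inequality for x ↦ η(s + x) - x η'(s), whose derivative is at most K|x| because η' is
Lipschitz. -/
lemma exists_taylor : ∃ K, 0 < K ∧ ∀ s u, ‖η (s + u) - η s - u * deriv η s‖ ≤ K * |u| ^ 2 := by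
  obtain ⟨K, hK, -, hl⟩ := exists_lipschitz_of_periodic hη.contDiff_deriv
    (periodic_deriv hη.periodic)
  refine ⟨K, hK, fun s u => ?_⟩
  have hd : ∀ x, HasDerivAt (fun x : ℝ => η (s + x) - x * deriv η s)
      (deriv η (s + x) - deriv η s) x := fun x => by
    have h1 := (hη.differentiable (s + x)).hasDerivAt.comp_const_add s x
    have h2 := ((hasDerivAt_id x).ofReal_comp).mul_const (deriv η s)
    exact (h1.sub h2).congr_deriv (by simp)
  have := (convex_uIcc 0 u).norm_image_sub_le_of_norm_deriv_le (C := K * |u|)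
    (fun x _ => (hd x).differentiableAt) (fun x hx => by
      rw [(hd x).deriv]
      refine (hl _ _).trans ?_
      have : |x - 0| ≤ |u - 0| := abs_sub_left_of_mem_uIcc hx
      simp only [sub_zero] at this
      simp only [add_sub_cancel_left]
      gcongr) left_mem_uIcc right_mem_uIcc
  simp only [add_zero, Complex.ofReal_zero, zero_mul, sub_zero, Real.norm_eq_abs] at this
  calc _ = ‖η (s + u) - u * deriv η s - η s‖ := by congr 1; ring
    _ ≤ _ := this
    _ = _ := by ring

/-- For small |u| the Taylor remainder is dominated by the linear term; for the remaining u,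
simplicity of the curve and compactness bound the chord from below. -/
lemma exists_chord : ∃ c, 0 < c ∧ ∀ s u, |u| ≤ π → c * |u| ≤ ‖η (s + u) - η s‖ := by
  obtain ⟨K, hK, ht⟩ := hη.exists_taylor
  obtain ⟨M, hM, hM'⟩ : ∃ M, 0 < M ∧ ∀ s, M ≤ ‖deriv η s‖ := by
    obtain ⟨x, -, hx⟩ := isCompact_Icc.exists_isMinOn (s := Icc 0 (2 * π))
      ⟨0, by simp [pi_pos.le]⟩ hη.continuous_deriv.norm.continuousOn
    refine ⟨‖deriv η x‖, norm_pos_iff.2 (hη.deriv_ne_zero x), fun s => ?_⟩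
    obtain ⟨y, hy, h⟩ := (periodic_deriv hη.periodic).exists_mem_Ico₀ two_pi_pos s
    rw [h]
    exact hx ⟨hy.1, hy.2.le⟩
  set δ := M / (2 * K) with hδ
  have hδ0 : 0 < δ := by positivity
  have hcpt : IsCompact (Icc 0 (2 * π) ×ˢ {u : ℝ | δ ≤ |u| ∧ |u| ≤ π}) := by
    refine isCompact_Icc.prod ?_
    refine (isCompact_Icc (a := -π) (b := π)).of_isClosed_subset ?_ fun u hu => abs_le.1 hu.2
    exact (isClosed_le continuous_const continuous_abs).inter
      (isClosed_le continuous_abs continuous_const)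
  obtain ⟨M', hM'0, hM''⟩ : ∃ M', 0 < M' ∧ ∀ s u, δ ≤ |u| → |u| ≤ π → M' ≤ ‖η (s + u) - η s‖ := by
    rcases (Icc 0 (2 * π) ×ˢ {u : ℝ | δ ≤ |u| ∧ |u| ≤ π}).eq_empty_or_nonempty with he | hne
    · refine ⟨1, one_pos, fun s u h1 h2 => ?_⟩
      have : ((0, u) : ℝ × ℝ) ∈ Icc 0 (2 * π) ×ˢ {u : ℝ | δ ≤ |u| ∧ |u| ≤ π} :=
        ⟨by simp [pi_pos.le], h1, h2⟩
      rw [he] at this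
      exact this.elim
    · obtain ⟨x, hx, hm⟩ := hcpt.exists_isMinOn hne
        (f := fun x : ℝ × ℝ => ‖η (x.1 + x.2) - η x.1‖)
        (((hη.continuous.comp (continuous_fst.add continuous_snd)).sub
          (hη.continuous.comp continuous_fst)).norm.continuousOn)
      refine ⟨_, norm_pos_iff.2 (hη.sub_ne_zero hx.2.2 (u := x.2) (s := x.1) ?_),
        fun s u h1 h2 => ?_⟩
      · intro h
        have := hx.2.1
        rw [h, abs_zero] at this
        linarith
      · have hp : Function.Periodic (fun s => ‖η (s + u) - η s‖) (2 * π) := fun s => by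
          simp only
          rw [hη.periodic, show s + 2 * π + u = s + u + 2 * π by ring, hη.periodic]
        obtain ⟨y, hy, h⟩ := hp.exists_mem_Ico₀ two_pi_pos s
        have hyu : ((y, u) : ℝ × ℝ) ∈ Icc 0 (2 * π) ×ˢ {u : ℝ | δ ≤ |u| ∧ |u| ≤ π} :=
          ⟨⟨hy.1, hy.2.le⟩, h1, h2⟩
        exact (hm hyu).trans h.ge
  -- M/2 serves |u| ≤ δ, where δ makes K|u|² at most M|u|/2; M'/π serves δ ≤ |u| ≤ π.
  refine ⟨min (M / 2) (M' / π), by positivity, fun s u hu => ?_⟩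
  rcases le_total |u| δ with h | h
  · have h1 : ‖(u : ℂ) * deriv η s‖ ≤ ‖η (s + u) - η s‖ + K * |u| ^ 2 := by
      calc _ = ‖(η (s + u) - η s) - (η (s + u) - η s - u * deriv η s)‖ := by congr 1; ring
        _ ≤ _ := (norm_sub_le _ _).trans (by gcongr; exact ht s u)
    rw [norm_mul, Complex.norm_real, Real.norm_eq_abs] at h1
    have h2 : |u| * M ≤ |u| * ‖deriv η s‖ := by gcongr; exact hM' s
    have h3 : K * |u| ^ 2 ≤ M / 2 * |u| := by
      have : K * |u| ≤ M / 2 := by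
        calc K * |u| ≤ K * δ := by gcongr
          _ = M / 2 := by rw [hδ]; field_simp
      nlinarith [abs_nonneg u]
    have h4 : min (M / 2) (M' / π) * |u| ≤ M / 2 * |u| := by gcongr; exact min_le_left _ _
    linarith
  · calc _ ≤ M' / π * π := by gcongr; exact min_le_right _ _
      _ = M' := by field_simp
      _ ≤ _ := hM'' s u h hu

/-- The first bound makes Hölder differences integrable against the kernel, the second controls the
kernel as the base point moves, and the third says that the pole in u has residue 1 at every base
point. At u = 0 both the kernel and the inverses take the value 0, so no exception is needed. -/
lemma exists_chordKernel_bounds : ∃ C, 0 < C ∧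
    (∀ s u, |u| ≤ π → ‖chordKernel η s u‖ ≤ C * |u|⁻¹) ∧
    (∀ s t u, |u| ≤ π → ‖chordKernel η s u - chordKernel η t u‖ ≤ C * |s - t| * |u|⁻¹) ∧
    ∀ s u, |u| ≤ π → ‖chordKernel η s u - (u : ℂ)⁻¹‖ ≤ C := by
  obtain ⟨c, hc, hch⟩ := hη.exists_chord
  obtain ⟨B, hB, hb⟩ := exists_bound_of_periodic hη.continuous_deriv (periodic_deriv hη.periodic)
  obtain ⟨L, hL, -, hl⟩ := exists_lipschitz_of_periodic hη.contDiff_deriv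
    (periodic_deriv hη.periodic)
  obtain ⟨K, hK, ht⟩ := hη.exists_taylor
  have key : ∀ s u, |u| ≤ π → u ≠ 0 → ‖η (s + u) - η s‖⁻¹ ≤ c⁻¹ * |u|⁻¹ := fun s u hu h0 => by
    rw [← mul_inv]
    have := abs_pos.2 h0
    exact inv_anti₀ (by positivity) (hch s u hu)
  have h1 : ∀ s u, |u| ≤ π → ‖chordKernel η s u‖ ≤ B * c⁻¹ * |u|⁻¹ := fun s u hu => by
    rcases eq_or_ne u 0 with rfl | h0
    · simp [chordKernel]
    rw [chordKernel, norm_div, div_eq_mul_inv, mul_assoc]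
    gcongr
    exacts [hb _, key s u hu h0]
  have h2 : ∀ s t u, |u| ≤ π → ‖chordKernel η s u - chordKernel η t u‖ ≤
      (L * c⁻¹ + B * c⁻¹ * c⁻¹ * L) * |s - t| * |u|⁻¹ := fun s t u hu => by
    rcases eq_or_ne u 0 with rfl | h0
    · simp [chordKernel]
    have hq : ‖(η (t + u) - η t) - (η (s + u) - η s)‖ ≤ L * |s - t| * |u| := by
      have hd : ∀ x, HasDerivAt (fun x : ℝ => η (t + x) - η (s + x))
          (deriv η (t + x) - deriv η (s + x)) x := fun x =>
        ((hη.differentiable (t + x)).hasDerivAt.comp_const_add t x).sub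
          ((hη.differentiable (s + x)).hasDerivAt.comp_const_add s x)
      have := convex_univ.norm_image_sub_le_of_norm_deriv_le (C := L * |s - t|)
        (fun x _ => (hd x).differentiableAt) (fun x _ => by
          rw [(hd x).deriv]
          refine (hl _ _).trans ?_
          rw [show t + x - (s + x) = t - s by ring, abs_sub_comm]) (mem_univ 0) (mem_univ u)
      simp only [add_zero, sub_zero, Real.norm_eq_abs] at this
      calc _ = ‖η (t + u) - η (s + u) - (η t - η s)‖ := by congr 1; ring
        _ ≤ _ := this
    have e : chordKernel η s u - chordKernel η t u =
        (deriv η (s + u) - deriv η (t + u)) * (η (s + u) - η s)⁻¹ +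
        deriv η (t + u) * (η (t + u) - η t)⁻¹ * (η (s + u) - η s)⁻¹ *
          ((η (t + u) - η t) - (η (s + u) - η s)) := by
      have e1 := hη.sub_ne_zero (s := s) hu h0
      have e2 := hη.sub_ne_zero (s := t) hu h0
      rw [chordKernel, chordKernel]
      field_simp
      ring
    rw [e]
    refine (norm_add_le _ _).trans ?_
    simp only [norm_mul, norm_inv]
    have hu0 : |u| ≠ 0 := abs_ne_zero.2 h0
    calc _ ≤ L * |s - t| * (c⁻¹ * |u|⁻¹) +
          B * (c⁻¹ * |u|⁻¹) * (c⁻¹ * |u|⁻¹) * (L * |s - t| * |u|) := by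
          gcongr
          · simpa using hl (s + u) (t + u)
          · exact key s u hu h0
          · exact hb _
          · exact key t u hu h0
          · exact key s u hu h0
      _ = _ := by field_simp
  have h3 : ∀ s u, |u| ≤ π → ‖chordKernel η s u - (u : ℂ)⁻¹‖ ≤ (K + L) * c⁻¹ := fun s u hu => by
    rcases eq_or_ne u 0 with rfl | h0
    · simp [chordKernel]; positivity
    have hu0 : |u| ≠ 0 := abs_ne_zero.2 h0
    have e : chordKernel η s u - (u : ℂ)⁻¹ = (u * (deriv η (s + u) - deriv η s) -
        (η (s + u) - η s - u * deriv η s)) * (η (s + u) - η s)⁻¹ * (u : ℂ)⁻¹ := by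
      have e1 := hη.sub_ne_zero (s := s) hu h0
      have e2 : (u : ℂ) ≠ 0 := by exact_mod_cast h0
      rw [chordKernel]
      field_simp
      ring
    rw [e, norm_mul, norm_mul, norm_inv, norm_inv, Complex.norm_real, Real.norm_eq_abs]
    calc _ ≤ (|u| * (L * |u|) + K * |u| ^ 2) * (c⁻¹ * |u|⁻¹) * |u|⁻¹ := by
          gcongr
          · refine (norm_sub_le _ _).trans (add_le_add ?_ (ht s u))
            rw [norm_mul, Complex.norm_real, Real.norm_eq_abs]
            gcongr
            simpa using hl (s + u) s
          · exact key s u hu h0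
      _ = _ := by field_simp; ring
  set C₁ := B * c⁻¹
  set C₂ := L * c⁻¹ + B * c⁻¹ * c⁻¹ * L
  set C₃ := (K + L) * c⁻¹
  have p1 : 0 < C₁ := by positivity
  have p2 : 0 < C₂ := by positivity
  have p3 : 0 < C₃ := by positivity
  refine ⟨C₁ + C₂ + C₃, by positivity, fun s u hu => (h1 s u hu).trans ?_,
    fun s t u hu => (h2 s t u hu).trans ?_, fun s u hu => (h3 s u hu).trans ?_⟩
  · gcongr; linarith
  · gcongr; linarith
  · linarith

lemma measurable_chordKernel (s : ℝ) : Measurable (chordKernel η s) := by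
  have h1 := hη.continuous_deriv.measurable
  have h2 := hη.continuous.measurable
  unfold chordKernel
  fun_prop

lemma exists_nearest (z : ℂ) (s₀ : ℝ) : ∃ σ, |σ - s₀| ≤ π ∧ ∀ t, ‖η σ - z‖ ≤ ‖η t - z‖ := by
  obtain ⟨σ, hσ, hm⟩ := isCompact_Icc.exists_isMinOn (s := Icc (s₀ - π) (s₀ + π))
    ⟨s₀, by constructor <;> linarith [pi_pos]⟩ (f := fun t => ‖η t - z‖)
    (hη.continuous.sub continuous_const).norm.continuousOn
  refine ⟨σ, abs_le.2 ⟨by linarith [hσ.1], by linarith [hσ.2]⟩, fun t => ?_⟩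
  obtain ⟨y, hy, h⟩ := hη.periodic.exists_mem_Ico two_pi_pos t (s₀ - π)
  rw [h]
  exact hm ⟨hy.1, by linarith [hy.2]⟩

lemma isClosed_range : IsClosed (range η) := by
  have : range η = η '' Icc 0 (2 * π) := by
    refine Subset.antisymm ?_ (image_subset_range _ _)
    rintro _ ⟨s, rfl⟩
    obtain ⟨y, hy, h⟩ := hη.periodic.exists_mem_Ico₀ two_pi_pos s
    exact ⟨y, ⟨hy.1, hy.2.le⟩, h.symm⟩
  rw [this]
  exact (isCompact_Icc.image hη.continuous).isClosed

end IsRegularCurve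

/-! ### Singular integral estimates and boundary limits for one curve -/

lemma intervalIntegrable_abs_rpow {r : ℝ} (hr : -1 < r) (a : ℝ) :
    IntervalIntegrable (fun u : ℝ => |u| ^ r) volume (-a) a := by
  have h : ∀ b : ℝ, 0 ≤ b → IntervalIntegrable (fun u : ℝ => |u| ^ r) volume 0 b := fun b hb =>
    (intervalIntegral.intervalIntegrable_rpow' (a := 0) (b := b) hr).congr fun u hu => by
      rw [uIoc_of_le hb] at hu
      simp only [abs_of_pos hu.1]
  have h' : ∀ b : ℝ, IntervalIntegrable (fun u : ℝ => |u| ^ r) volume 0 b := fun b => by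
    rcases le_total 0 b with hb | hb
    · exact h b hb
    · have := (IntervalIntegrable.iff_comp_neg (f := fun u : ℝ => |u| ^ r)).1 (h (-b) (by linarith))
      simpa using this
  exact (h' _).symm.trans (h' _)

lemma abs_le_of_mem_uIoc_neg {a u : ℝ} (ha : 0 ≤ a) (hu : u ∈ uIoc (-a) a) : |u| ≤ a := by
  rw [uIoc_of_le (by linarith)] at hu
  exact abs_le.2 ⟨hu.1.le, hu.2⟩

lemma intervalIntegral_eq_symm_of_periodic {f : ℝ → ℂ} (hf : Function.Periodic f (2 * π)) (s : ℝ) :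
    ∫ t in (0 : ℝ)..(2 * π), f t = ∫ u in (-π)..π, f (s + u) := by
  rw [intervalIntegral.integral_comp_add_left f s]
  have := hf.intervalIntegral_add_eq 0 (s + -π)
  rw [zero_add, show s + -π + 2 * π = s + π by ring] at this
  exact this

/-- The singular Cauchy integral of the density `ψ`, regularized by subtracting `ψ s`. -/
def regCauchy (η ψ : ℝ → ℂ) (s : ℝ) : ℂ :=
  ∫ u in (-π)..π, (ψ (s + u) - ψ s) * chordKernel η s u

/-- The Cauchy integral of a single curve, without the factor `1 / (2πi)`. -/
def cauchyTerm (η ψ : ℝ → ℂ) (z : ℂ) : ℂ :=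
  ∫ t in (0 : ℝ)..(2 * π), ψ t * (deriv η t / (η t - z))

lemma rpow_mul_inv_abs {u : ℝ} (hu : u ≠ 0) (α : ℝ) : |u| ^ α * |u|⁻¹ = |u| ^ (α - 1) := by
  rw [rpow_sub_one (abs_ne_zero.2 hu), div_eq_mul_inv]

lemma norm_mul_chordKernel_le {η ψ : ℝ → ℂ} {α C D : ℝ} (hD : 0 ≤ D)
    (hψ : ∀ s t, ‖ψ s - ψ t‖ ≤ C * |s - t| ^ α)
    (hk : ∀ s u, |u| ≤ π → ‖chordKernel η s u‖ ≤ D * |u|⁻¹) (s u : ℝ) (hu : |u| ≤ π) :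
    ‖(ψ (s + u) - ψ s) * chordKernel η s u‖ ≤ C * D * |u| ^ (α - 1) := by
  rcases eq_or_ne u 0 with rfl | h0
  · have h1 := hψ 1 0
    simp only [sub_zero, abs_one, one_rpow, mul_one] at h1
    have : 0 ≤ C := (norm_nonneg _).trans h1
    simp only [add_zero, sub_self, zero_mul, norm_zero]
    positivity
  rw [norm_mul, ← rpow_mul_inv_abs h0]
  calc _ ≤ (C * |u| ^ α) * (D * |u|⁻¹) := by
        gcongr
        · have := hψ (s + u) s
          have h0 : 0 ≤ ‖ψ (s + u) - ψ s‖ := norm_nonneg _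
          simp only [add_sub_cancel_left] at this
          linarith
        · simpa using hψ (s + u) s
        · exact hk s u hu
    _ = _ := by ring

/-- The second difference is at most 2C|u|^α and at most 2C|s - t|^α, hence at most the geometric
mean of the two. -/
lemma sub_le_rpow_half {ψ : ℝ → ℂ} {α C : ℝ} (hα : 0 < α) (hC : 0 ≤ C)
    (hψ : ∀ s t, ‖ψ s - ψ t‖ ≤ C * |s - t| ^ α) (s t u : ℝ) :
    ‖(ψ (s + u) - ψ s) - (ψ (t + u) - ψ t)‖ ≤
      2 * C * |s - t| ^ (α / 2) * |u| ^ (α / 2) := by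
  have e : ∀ x : ℝ, |x| ^ α = |x| ^ (α / 2) * |x| ^ (α / 2) := fun x => by
    rw [← rpow_add_of_nonneg (abs_nonneg _) (by linarith) (by linarith), add_halves]
  rcases le_total |u| |s - t| with h | h
  · calc _ ≤ C * |u| ^ α + C * |u| ^ α := by
          refine (norm_sub_le _ _).trans (add_le_add ?_ ?_)
          · simpa using hψ (s + u) s
          · simpa using hψ (t + u) t
      _ = 2 * C * |u| ^ (α / 2) * |u| ^ (α / 2) := by rw [e]; ring
      _ ≤ _ := by gcongr
  · calc _ = ‖(ψ (s + u) - ψ (t + u)) - (ψ s - ψ t)‖ := by congr 1; ring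
      _ ≤ C * |s - t| ^ α + C * |s - t| ^ α := by
          refine (norm_sub_le _ _).trans (add_le_add ?_ (hψ s t))
          simpa using hψ (s + u) (t + u)
      _ = 2 * C * |s - t| ^ (α / 2) * |s - t| ^ (α / 2) := by rw [e]; ring
      _ ≤ _ := by gcongr

namespace IsRegularCurve

variable {η : ℝ → ℂ} (hη : IsRegularCurve η)
include hη

section

variable {ψ : ℝ → ℂ} {α : ℝ}

lemma intervalIntegrable_regCauchy (hα : 0 < α) (hψ : BddHolder α ψ) (s : ℝ) :
    IntervalIntegrable (fun u => (ψ (s + u) - ψ s) * chordKernel η s u) volume (-π) π := by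
  have hc := hψ.continuous hα
  obtain ⟨C, hC, -, hl⟩ := hψ
  obtain ⟨D, hD, hk, -⟩ := hη.exists_chordKernel_bounds
  refine ((intervalIntegrable_abs_rpow (r := α - 1) (by linarith) π).const_mul (C * D)).mono_fun'
    ?_ ?_
  · exact ((by fun_prop : Continuous fun u => ψ (s + u) - ψ s).measurable.mul
      (hη.measurable_chordKernel s)).aestronglyMeasurable
  · refine (ae_restrict_iff' measurableSet_uIoc).2 (ae_of_all _ fun u hu => ?_)
    exact norm_mul_chordKernel_le hD.le hl hk s u (abs_le_of_mem_uIoc_neg pi_pos.le hu)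

/-- Half of the Hölder exponent is spent on |s - t|; the other half keeps |u|^(α/2 - 1) integrable.
This crude loss suffices, since only some positive exponent is needed. -/
lemma bddHolder_regCauchy (hα : 0 < α) (hα1 : α ≤ 1) (hψ : BddHolder α ψ) :
    BddHolder (α / 2) (regCauchy η ψ) := by
  have hint := hη.intervalIntegrable_regCauchy hα hψ
  obtain ⟨C, hC, -, hl⟩ := hψ
  obtain ⟨D, hD, hk, hk', -⟩ := hη.exists_chordKernel_bounds
  have i1 := intervalIntegrable_abs_rpow (r := α - 1) (by linarith) π
  have i2 := intervalIntegrable_abs_rpow (r := α / 2 - 1) (by linarith) π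
  set I₁ := ∫ u in (-π)..π, |u| ^ (α - 1) with hI₁
  set I₂ := ∫ u in (-π)..π, |u| ^ (α / 2 - 1) with hI₂
  have hpi : -π ≤ π := by linarith [pi_pos]
  have n1 : 0 ≤ I₁ := intervalIntegral.integral_nonneg hpi fun u _ => by positivity
  have n2 : 0 ≤ I₂ := intervalIntegral.integral_nonneg hpi fun u _ => by positivity
  have hb : ∀ s, ‖regCauchy η ψ s‖ ≤ C * D * I₁ := fun s => by
    rw [hI₁, ← intervalIntegral.integral_const_mul]
    refine intervalIntegral.norm_integral_le_of_norm_le hpi (ae_of_all _ fun u hu => ?_)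
      (i1.const_mul _)
    exact norm_mul_chordKernel_le hD.le hl hk s u (abs_le.2 ⟨hu.1.le, hu.2⟩)
  have hd : ∀ s t, |s - t| ≤ 1 → ‖regCauchy η ψ s - regCauchy η ψ t‖ ≤
      (2 * C * D * I₂ + C * D * I₁) * |s - t| ^ (α / 2) := fun s t hst => by
    rw [regCauchy, regCauchy, ← intervalIntegral.integral_sub (hint s) (hint t)]
    have : (2 * C * D * I₂ + C * D * I₁) * |s - t| ^ (α / 2) = ∫ u in (-π)..π,
        (2 * C * D * |s - t| ^ (α / 2) * |u| ^ (α / 2 - 1) +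
          C * D * |s - t| ^ (α / 2) * |u| ^ (α - 1)) := by
      rw [intervalIntegral.integral_add (i2.const_mul _) (i1.const_mul _),
        intervalIntegral.integral_const_mul, intervalIntegral.integral_const_mul]
      ring
    rw [this]
    refine intervalIntegral.norm_integral_le_of_norm_le hpi (ae_of_all _ fun u hu => ?_)
      ((i2.const_mul _).add (i1.const_mul _))
    have hu' : |u| ≤ π := abs_le.2 ⟨hu.1.le, hu.2⟩
    rcases eq_or_ne u 0 with rfl | h0
    · simp only [add_zero, sub_self, zero_mul, norm_zero]; positivity
    have hst' : |s - t| ≤ |s - t| ^ (α / 2) := by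
      rcases eq_or_ne |s - t| 0 with h | h
      · rw [h, zero_rpow (by linarith)]
      · nth_rewrite 1 [← rpow_one |s - t|]
        exact rpow_le_rpow_of_exponent_ge (lt_of_le_of_ne (abs_nonneg _) h.symm) hst (by linarith)
    -- The change of density difference and the change of kernel are separated; the former is
    -- handled by interpolation, the latter by Lipschitz dependence on the base point.
    calc _ = ‖((ψ (s + u) - ψ s) - (ψ (t + u) - ψ t)) * chordKernel η s u +
          (ψ (t + u) - ψ t) * (chordKernel η s u - chordKernel η t u)‖ := by congr 1; ring
      _ ≤ (2 * C * |s - t| ^ (α / 2) * |u| ^ (α / 2)) * (D * |u|⁻¹) +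
          (C * |u| ^ α) * (D * |s - t| * |u|⁻¹) := by
        refine (norm_add_le _ _).trans ?_
        rw [norm_mul, norm_mul]
        gcongr
        · exact sub_le_rpow_half hα hC hl s t u
        · exact hk s u hu'
        · simpa using hl (t + u) t
        · exact hk' s t u hu'
      _ ≤ (2 * C * |s - t| ^ (α / 2) * |u| ^ (α / 2)) * (D * |u|⁻¹) +
          (C * |u| ^ α) * (D * |s - t| ^ (α / 2) * |u|⁻¹) := by gcongr
      _ = _ := by rw [← rpow_mul_inv_abs h0, ← rpow_mul_inv_abs h0]; ring
  refine ⟨2 * (C * D * I₁) + (2 * C * D * I₂ + C * D * I₁), by positivity,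
    fun s => (hb s).trans ?_, fun s t => ?_⟩
  · have : 0 ≤ C * D * I₁ := by positivity
    have : 0 ≤ C * D * I₂ := by positivity
    linarith
  · rcases le_total |s - t| 1 with h | h
    · refine (hd s t h).trans (mul_le_mul_of_nonneg_right ?_ (by positivity))
      have : 0 ≤ C * D * I₁ := by positivity
      linarith
    · calc _ ≤ C * D * I₁ + C * D * I₁ := (norm_sub_le _ _).trans (add_le_add (hb s) (hb t))
        _ ≤ (2 * (C * D * I₁) + (2 * C * D * I₂ + C * D * I₁)) * 1 := by
          have : 0 ≤ C * D * I₁ := by positivity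
          have : 0 ≤ C * D * I₂ := by positivity
          linarith
        _ ≤ _ := by gcongr; exact one_le_rpow h (by linarith)

lemma continuous_cauchy_integrand (hψ : Continuous ψ) {z : ℂ} (hz : z ∉ range η) :
    Continuous fun t => ψ t * (deriv η t / (η t - z)) :=
  hψ.mul (hη.continuous_deriv.div (hη.continuous.sub continuous_const)
    fun t h => hz ⟨t, sub_eq_zero.1 h⟩)

lemma periodic_cauchy_integrand (hp : Function.Periodic ψ (2 * π)) (z : ℂ) :
    Function.Periodic (fun t => ψ t * (deriv η t / (η t - z))) (2 * π) := fun t => by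
  simp only
  rw [hp, hη.periodic, periodic_deriv hη.periodic]

lemma cauchyTerm_eq (hψ : Continuous ψ) (hp : Function.Periodic ψ (2 * π)) {z : ℂ}
    (hz : z ∉ range η) (s : ℝ) : cauchyTerm η ψ z =
      (∫ u in (-π)..π, (ψ (s + u) - ψ s) * (deriv η (s + u) / (η (s + u) - z))) +
        ψ s * cauchyTerm η (fun _ => 1) z := by
  rw [cauchyTerm, cauchyTerm,
    intervalIntegral_eq_symm_of_periodic (hη.periodic_cauchy_integrand hp z) s,
    intervalIntegral_eq_symm_of_periodic
      (hη.periodic_cauchy_integrand (ψ := fun _ => 1) (fun _ => rfl) z) s,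
    ← intervalIntegral.integral_const_mul, ← intervalIntegral.integral_add]
  · congr 1
    ext u
    ring
  · exact ((hη.continuous_cauchy_integrand (ψ := fun t => ψ t - ψ s) (hψ.sub continuous_const)
      hz).comp (continuous_const.add continuous_id)).intervalIntegrable _ _
  · exact ((continuous_const.mul (hη.continuous_cauchy_integrand (ψ := fun _ => 1)
      continuous_const hz)).comp (continuous_const.add continuous_id)).intervalIntegrable _ _

/-- With σ a parameter of a point nearest to z and d = |η(σ) - z|, every x = |η(σ + u) - z| is at
least d and at least half the chord |η(σ + u) - η(σ)|. The difference of the two kernels carries a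
factor d, and these inequalities trade d for d^(α/2) times an integrable power of |u|. No
nontangential condition on z is needed. -/
lemma exists_approach_bound (hα : 0 < α) (hα1 : α ≤ 1) (hψ : BddHolder α ψ) :
    ∃ C, ∀ z ∉ range η, ∀ σ, (∀ t, ‖η σ - z‖ ≤ ‖η t - z‖) →
      ‖(∫ u in (-π)..π, (ψ (σ + u) - ψ σ) * (deriv η (σ + u) / (η (σ + u) - z))) -
        regCauchy η ψ σ‖ ≤ C * ‖η σ - z‖ ^ (α / 2) := by
  have hint := hη.intervalIntegrable_regCauchy hα hψ
  have hcont := hψ.continuous hα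
  obtain ⟨C, hC, -, hl⟩ := hψ
  obtain ⟨c, hc, hch⟩ := hη.exists_chord
  obtain ⟨B, hB, hb⟩ := exists_bound_of_periodic hη.continuous_deriv (periodic_deriv hη.periodic)
  have i2 := intervalIntegrable_abs_rpow (r := α / 2 - 1) (by linarith) π
  set β := α / 2 with hβ
  have hβ0 : 0 < β := by rw [hβ]; linarith
  refine ⟨C * B * (2 ^ β * (c ^ β)⁻¹ * c⁻¹) * ∫ u in (-π)..π, |u| ^ (β - 1),
    fun z hz σ hσ => ?_⟩
  rw [regCauchy, ← intervalIntegral.integral_sub _ (hint σ)]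
  swap
  · exact ((hη.continuous_cauchy_integrand (ψ := fun t => ψ t - ψ σ) (hcont.sub continuous_const)
      hz).comp (continuous_const.add continuous_id)).intervalIntegrable _ _
  set d := ‖η σ - z‖ with hd
  rw [mul_right_comm, ← intervalIntegral.integral_const_mul]
  refine intervalIntegral.norm_integral_le_of_norm_le (by linarith [pi_pos])
    (ae_of_all _ fun u hu => ?_) (i2.const_mul _)
  have hu' : |u| ≤ π := abs_le.2 ⟨hu.1.le, hu.2⟩
  rcases eq_or_ne u 0 with rfl | h0
  · simp only [add_zero, sub_self, zero_mul, norm_zero]; positivity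
  have hu0 : 0 < |u| := abs_pos.2 h0
  have e1 := hη.sub_ne_zero (s := σ) hu' h0
  have e2 : η (σ + u) - z ≠ 0 := fun h => hz ⟨_, sub_eq_zero.1 h⟩
  set x := ‖η (σ + u) - z‖ with hx
  set y := ‖η (σ + u) - η σ‖ with hy
  have hx0 : 0 < x := norm_pos_iff.2 e2
  have hdx : d ≤ x := hσ _
  have hy2 : y ≤ 2 * x := by
    calc y = ‖(η (σ + u) - z) - (η σ - z)‖ := by rw [hy]; congr 1; ring
      _ ≤ x + d := norm_sub_le _ _
      _ ≤ _ := by linarith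
  have hcy : c * |u| ≤ y := hch σ u hu'
  have hd0 : 0 < d := norm_pos_iff.2 fun h => hz ⟨_, sub_eq_zero.1 h⟩
  -- The factor d is split as d^β d^(1-β), and the second power is absorbed into x, leaving x^(-β),
  -- which the chord bound controls.
  have hdb : d ≤ d ^ β * x ^ (1 - β) := by
    calc d = d ^ β * d ^ (1 - β) := by rw [← rpow_add hd0]; simp
      _ ≤ _ := by gcongr; linarith
  have hxb : (x ^ β)⁻¹ ≤ 2 ^ β * (c ^ β)⁻¹ * (|u| ^ β)⁻¹ := by
    have : (c * |u| / 2) ^ β ≤ x ^ β := by gcongr; linarith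
    calc (x ^ β)⁻¹ ≤ ((c * |u| / 2) ^ β)⁻¹ := inv_anti₀ (by positivity) this
      _ = _ := by
        rw [div_rpow (by positivity) (by norm_num), mul_rpow hc.le hu0.le]
        field_simp
  have hmain : d * (x⁻¹ * y⁻¹) ≤
      d ^ β * (2 ^ β * (c ^ β)⁻¹ * (|u| ^ β)⁻¹ * (c⁻¹ * |u|⁻¹)) := by
    calc d * (x⁻¹ * y⁻¹) ≤ (d ^ β * x ^ (1 - β)) * (x⁻¹ * y⁻¹) := by gcongr
      _ = d ^ β * ((x ^ β)⁻¹ * y⁻¹) := by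
        rw [rpow_sub hx0, rpow_one]; field_simp
      _ ≤ _ := by
        gcongr
        rw [← mul_inv]
        exact inv_anti₀ (by positivity) hcy
  have e : (ψ (σ + u) - ψ σ) * (deriv η (σ + u) / (η (σ + u) - z)) -
      (ψ (σ + u) - ψ σ) * chordKernel η σ u =
      (ψ (σ + u) - ψ σ) * deriv η (σ + u) *
        (-(η σ - z) * ((η (σ + u) - z)⁻¹ * (η (σ + u) - η σ)⁻¹)) := by
    rw [chordKernel]
    field_simp
    ring
  rw [e]
  simp only [norm_mul, norm_inv, norm_neg]
  calc _ ≤ (C * |u| ^ α) * B * (d ^ β * (2 ^ β * (c ^ β)⁻¹ * (|u| ^ β)⁻¹ * (c⁻¹ * |u|⁻¹))) := by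
        gcongr
        · simpa using hl (σ + u) σ
        · exact hb _
    _ = _ := by
        rw [← rpow_mul_inv_abs h0, show α = β + β by rw [hβ]; ring, rpow_add hu0]
        field_simp

/-- The base point is moved to a nearest parameter σ(z), which tends to s₀; then the approach bound
and the continuity of the direct value combine. Constancy of the winding integral on the approach
set fixes the jump term. -/
lemma tendsto_cauchyTerm (hα : 0 < α) (hα1 : α ≤ 1) (hψ : BddHolder α ψ)
    (hp : Function.Periodic ψ (2 * π)) {S : Set ℂ} {s₀ : ℝ} {w : ℂ}
    (hS : ∀ᶠ z in 𝓝[S] (η s₀), z ∉ range η ∧ cauchyTerm η (fun _ => 1) z = w) :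
    Tendsto (cauchyTerm η ψ) (𝓝[S] (η s₀)) (𝓝 (regCauchy η ψ s₀ + ψ s₀ * w)) := by
  have hcont := hψ.continuous hα
  have hF := (hη.bddHolder_regCauchy hα hα1 hψ).continuous (by linarith)
  obtain ⟨C, hC⟩ := hη.exists_approach_bound hα hα1 hψ
  obtain ⟨c, hc, hch⟩ := hη.exists_chord
  -- The nearest parameter is taken within π of s₀, so that the chord bound turns convergence of
  -- η(σ(z)) into convergence of σ(z).
  choose σ hσ hσm using fun z => hη.exists_nearest z s₀
  have hz0 : Tendsto (fun z => ‖η s₀ - z‖) (𝓝[S] (η s₀)) (𝓝 0) := by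
    have : Continuous fun z => ‖η s₀ - z‖ := (continuous_const.sub continuous_id).norm
    simpa using (this.tendsto (η s₀)).mono_left nhdsWithin_le_nhds
  have hd0 : Tendsto (fun z => ‖η (σ z) - z‖) (𝓝[S] (η s₀)) (𝓝 0) :=
    squeeze_zero (fun _ => norm_nonneg _) (fun z => hσm z s₀) hz0
  have hσ0 : Tendsto σ (𝓝[S] (η s₀)) (𝓝 s₀) := by
    rw [tendsto_iff_norm_sub_tendsto_zero]
    refine squeeze_zero (fun _ => norm_nonneg _) (g := fun z => 2 / c * ‖η s₀ - z‖) (fun z => ?_)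
      (by simpa using hz0.const_mul (2 / c))
    have h1 := hch s₀ (σ z - s₀) (hσ z)
    rw [add_sub_cancel] at h1
    have h2 : ‖η (σ z) - η s₀‖ ≤ ‖η (σ z) - z‖ + ‖η s₀ - z‖ := by
      calc _ = ‖(η (σ z) - z) - (η s₀ - z)‖ := by congr 1; ring
        _ ≤ _ := norm_sub_le _ _
    have h3 := hσm z s₀
    rw [Real.norm_eq_abs, div_mul_eq_mul_div, le_div_iff₀ hc]
    linarith
  have hlim : Tendsto (fun z => (regCauchy η ψ (σ z) + ψ (σ z) * w)) (𝓝[S] (η s₀))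
      (𝓝 (regCauchy η ψ s₀ + ψ s₀ * w)) :=
    ((hF.tendsto s₀).comp hσ0).add (((hcont.tendsto s₀).comp hσ0).mul_const w)
  have hdiff : Tendsto (fun z => cauchyTerm η ψ z - (regCauchy η ψ (σ z) + ψ (σ z) * w))
      (𝓝[S] (η s₀)) (𝓝 0) := by
    refine squeeze_zero_norm' (a := fun z => C * ‖η (σ z) - z‖ ^ (α / 2)) ?_ ?_
    · filter_upwards [hS] with z hz
      rw [hη.cauchyTerm_eq hcont hp hz.1 (σ z), hz.2, add_sub_add_right_eq_sub]
      exact hC z hz.1 (σ z) (hσm z)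
    · have := (hd0.rpow_const (p := α / 2) (Or.inr (by linarith))).const_mul C
      simpa [zero_rpow (show α / 2 ≠ 0 by positivity)] using this
  simpa using hdiff.add hlim

end

/-! ### Analyticity, behaviour at infinity and winding integrals -/

lemma hasDerivAt_cauchyTerm {ψ : ℝ → ℂ} (hψ : Continuous ψ) {z : ℂ} (hz : z ∉ range η) :
    HasDerivAt (cauchyTerm η ψ)
      (∫ t in (0 : ℝ)..(2 * π), ψ t * (deriv η t / (η t - z) ^ 2)) z := by
  obtain ⟨ε, hε, hball⟩ := Metric.isOpen_iff.1 hη.isClosed_range.isOpen_compl z hz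
  have hfar : ∀ w ∈ Metric.ball z (ε / 2), ∀ t, ε / 2 ≤ ‖η t - w‖ := fun w hw t => by
    by_contra! h
    refine hball (a := η t) ?_ ⟨t, rfl⟩
    rw [Metric.mem_ball, dist_eq_norm] at hw ⊢
    calc ‖η t - z‖ = ‖(η t - w) + (w - z)‖ := by congr 1; ring
      _ ≤ _ := norm_add_le _ _
      _ < _ := by linarith
  have hnr : ∀ w ∈ Metric.ball z (ε / 2), w ∉ range η := by
    rintro w hw ⟨t, rfl⟩
    have := hfar _ hw t
    simp only [sub_self, norm_zero] at this
    linarith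
  have hcont : Continuous fun t => ψ t * (deriv η t / (η t - z) ^ 2) :=
    hψ.mul (hη.continuous_deriv.div ((hη.continuous.sub continuous_const).pow 2)
      fun t h => hz ⟨t, sub_eq_zero.1 (pow_eq_zero_iff two_ne_zero |>.1 h)⟩)
  refine (intervalIntegral.hasDerivAt_integral_of_dominated_loc_of_deriv_le
    (F := fun w t => ψ t * (deriv η t / (η t - w)))
    (F' := fun w t => ψ t * (deriv η t / (η t - w) ^ 2))
    (bound := fun t => ‖ψ t‖ * (‖deriv η t‖ / (ε / 2) ^ 2))
    (Metric.ball_mem_nhds z (half_pos hε)) ?_ ?_ ?_ ?_ ?_ ?_).2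
  · filter_upwards [Metric.ball_mem_nhds z (half_pos hε)] with w hw
    exact (hη.continuous_cauchy_integrand hψ (hnr w hw)).aestronglyMeasurable
  · exact (hη.continuous_cauchy_integrand hψ hz).intervalIntegrable _ _
  · exact hcont.aestronglyMeasurable
  · refine ae_of_all _ fun t _ w hw => ?_
    rw [norm_mul, norm_div, norm_pow]
    have := hfar w hw t
    gcongr
  · exact (hψ.norm.mul (hη.continuous_deriv.norm.div_const _)).intervalIntegrable _ _
  · refine ae_of_all _ fun t _ w hw => ?_
    have hne : η t - w ≠ 0 := fun h => hnr w hw ⟨t, sub_eq_zero.1 h⟩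
    have h1 := ((hasDerivAt_id w).const_sub (η t)).inv hne
    have h2 := (h1.const_mul (deriv η t)).const_mul (ψ t)
    simp only [id_eq, neg_neg] at h2
    simpa [div_eq_mul_inv] using h2

lemma tendsto_cauchyTerm_cocompact {ψ : ℝ → ℂ} (hψ : Continuous ψ) :
    Tendsto (cauchyTerm η ψ) (cocompact ℂ) (𝓝 0) := by
  obtain ⟨B, hB, hb⟩ := exists_bound_of_periodic hη.continuous hη.periodic
  -- Dominated convergence along a filter requires countable generation.
  have : (cocompact ℂ).IsCountablyGenerated := by
    rw [← Metric.cobounded_eq_cocompact, ← comap_norm_atTop]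
    infer_instance
  have key : Tendsto (fun z => ∫ t in (0 : ℝ)..(2 * π), ψ t * (deriv η t / (η t - z)))
      (cocompact ℂ) (𝓝 (∫ t in (0 : ℝ)..(2 * π), (0 : ℂ))) := by
    have hlarge : ∀ᶠ z : ℂ in cocompact ℂ, B + 1 ≤ ‖z‖ :=
      (tendsto_norm_cocompact_atTop (E := ℂ)).eventually_ge_atTop _
    have hfar : ∀ z : ℂ, B + 1 ≤ ‖z‖ → ∀ t, 1 ≤ ‖η t - z‖ := fun z hz t => by
      have := norm_sub_norm_le z (η t)
      rw [norm_sub_rev] at this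
      linarith [hb t]
    refine intervalIntegral.tendsto_integral_filter_of_dominated_convergence
      (fun t => ‖ψ t‖ * ‖deriv η t‖) ?_ ?_ ?_ ?_
    · filter_upwards [hlarge] with z hz
      refine (hη.continuous_cauchy_integrand hψ ?_).aestronglyMeasurable
      rintro ⟨t, rfl⟩
      have := hfar _ hz t
      simp only [sub_self, norm_zero] at this
      linarith
    · filter_upwards [hlarge] with z hz
      refine ae_of_all _ fun t _ => ?_
      rw [norm_mul, norm_div]
      gcongr
      exact div_le_self (norm_nonneg _) (hfar z hz t)
    · exact (hψ.norm.mul hη.continuous_deriv.norm).intervalIntegrable _ _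
    · refine ae_of_all _ fun t _ => ?_
      have h1 : Tendsto (fun z => η t - z) (cocompact ℂ) (cocompact ℂ) :=
        (Homeomorph.subLeft (η t)).isClosedEmbedding.tendsto_cocompact
      have h2 := (tendsto_inv₀_cobounded (α := ℂ)).comp (Metric.cobounded_eq_cocompact (α := ℂ) ▸ h1)
      have h3 := (h2.const_mul (deriv η t)).const_mul (ψ t)
      simpa [div_eq_mul_inv, ← Metric.cobounded_eq_cocompact] using h3
  rw [intervalIntegral.integral_zero] at key
  exact key

/-- The differentiated integrand is the exact derivative of -(η(t) - z)⁻¹, so its integral over a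
period vanishes. -/
lemma deriv_winding_integral {z : ℂ} (hz : z ∉ range η) :
    deriv (cauchyTerm η (fun _ => 1)) z = 0 := by
  rw [(hη.hasDerivAt_cauchyTerm continuous_const hz).deriv]
  have hne : ∀ t, η t - z ≠ 0 := fun t h => hz ⟨t, sub_eq_zero.1 h⟩
  have hd : ∀ t ∈ uIcc 0 (2 * π), HasDerivAt (fun t => -(η t - z)⁻¹)
      (1 * (deriv η t / (η t - z) ^ 2)) t := fun t _ => by
    have := (((hη.differentiable t).hasDerivAt.sub_const z).inv (hne t)).neg
    refine this.congr_deriv ?_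
    ring
  rw [intervalIntegral.integral_eq_sub_of_hasDerivAt hd]
  · have := hη.periodic 0
    rw [zero_add] at this
    rw [this, sub_self]
  · exact (continuous_const.mul (hη.continuous_deriv.div ((hη.continuous.sub
      continuous_const).pow 2) fun t => pow_ne_zero 2 (hne t))).intervalIntegrable _ _

/-- The winding number vanishes on unbounded connected open sets off the curve. -/
lemma winding_integral_eq_zero {G : Set ℂ} (hG : IsOpen G) (hc : IsPreconnected G)
    (hb : Bornology.IsBounded Gᶜ) (hd : Disjoint G (range η)) {z : ℂ} (hz : z ∈ G) :
    cauchyTerm η (fun _ => 1) z = 0 := by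
  have hG' : ∀ w ∈ G, w ∉ range η := fun w hw => Set.disjoint_left.1 hd hw
  have hconst : ∀ w ∈ G, cauchyTerm η (fun _ => 1) w = cauchyTerm η (fun _ => 1) z := fun w hw =>
    hG.is_const_of_deriv_eq_zero hc
      (fun w hw => (hη.hasDerivAt_cauchyTerm continuous_const
        (hG' w hw)).differentiableAt.differentiableWithinAt)
      (fun w hw => hη.deriv_winding_integral (hG' w hw)) hw hz
  have hev : ∀ᶠ w in cocompact ℂ, w ∈ G := by
    rw [← Metric.cobounded_eq_cocompact]
    simpa using Bornology.isBounded_def.1 hb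
  -- The winding integral is constant on G and tends to 0 at infinity, a neighbourhood of which lies
  -- in G.
  refine tendsto_nhds_unique (f := fun _ : ℂ => cauchyTerm η (fun _ => 1) z)
    (l := cocompact ℂ) tendsto_const_nhds ?_
  refine (hη.tendsto_cauchyTerm_cocompact (ψ := fun _ => 1) continuous_const).congr' ?_
  filter_upwards [hev] with w hw using hconst w hw

end IsRegularCurve

/-! ### The principal value of the Cauchy kernel -/

/-- The principal value of the integral of the Cauchy kernel of a closed curve. -/
def pvCauchy (η : ℝ → ℂ) (s : ℝ) : ℂ := ∫ u in (-π)..π, (chordKernel η s u - (u : ℂ)⁻¹)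

lemma ofReal_sub_I_mul_ne_zero {ε τ : ℝ} (hε : 0 < ε) (hτ : τ ^ 2 = 1) (u : ℝ) :
    (u : ℂ) - Complex.I * (τ * ε : ℝ) ≠ 0 := fun h => by
  have h1 := congrArg Complex.im h
  simp at h1
  rcases h1 with h1 | h1
  · simp [h1] at hτ
  · exact hε.ne' h1

lemma half_le_norm_ofReal_sub {ε τ : ℝ} (hε : 0 < ε) (hτ : τ ^ 2 = 1) (u : ℝ) :
    (|u| + ε) / 2 ≤ ‖(u : ℂ) - Complex.I * (τ * ε : ℝ)‖ := by
  have h1 := Complex.abs_re_le_norm ((u : ℂ) - Complex.I * (τ * ε : ℝ))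
  have h2 := Complex.abs_im_le_norm ((u : ℂ) - Complex.I * (τ * ε : ℝ))
  have hτ' : |τ| = 1 := by
    rw [← sq_abs] at hτ
    nlinarith [abs_nonneg τ]
  simp [abs_mul, hτ', abs_of_pos hε] at h1 h2
  simp only [Complex.ofReal_mul] at *
  linarith

/-- The model integral for the flattened curve: the logarithmic part of the primitive is even and
cancels, the arctangent part survives. The sign τ selects the side of the curve. -/
lemma integral_inv_ofReal_sub {ε τ : ℝ} (hε : 0 < ε) (hτ : τ ^ 2 = 1) :
    ∫ u in (-π)..π, ((u : ℂ) - Complex.I * (τ * ε : ℝ))⁻¹ =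
      Complex.I * τ * (2 * arctan (π / ε) : ℝ) := by
  have hd : ∀ u ∈ uIcc (-π) π, HasDerivAt (fun u : ℝ => ((log (u ^ 2 + ε ^ 2) / 2 : ℝ) : ℂ) +
      Complex.I * τ * (arctan (u / ε) : ℝ)) (((u : ℂ) - Complex.I * (τ * ε : ℝ))⁻¹) u := fun u _ => by
    have hp : u ^ 2 + ε ^ 2 ≠ 0 := by positivity
    have h1 : HasDerivAt (fun u : ℝ => log (u ^ 2 + ε ^ 2) / 2) (u / (u ^ 2 + ε ^ 2)) u :=
      ((((hasDerivAt_pow 2 u).add_const (ε ^ 2)).log hp).div_const 2).congr_deriv (by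
        simp only [Nat.add_one_sub_one, pow_one, Nat.cast_ofNat]
        field_simp)
    have h2 : HasDerivAt (fun u : ℝ => arctan (u / ε)) (ε / (u ^ 2 + ε ^ 2)) u :=
      ((hasDerivAt_id u).div_const ε).arctan.congr_deriv (by
        simp only [id_eq]
        field_simp
        ring)
    refine (h1.ofReal_comp.add (h2.ofReal_comp.const_mul (Complex.I * τ))).congr_deriv ?_
    have hne := ofReal_sub_I_mul_ne_zero hε hτ u
    have hpc : (u : ℂ) ^ 2 + (ε : ℂ) ^ 2 ≠ 0 := by exact_mod_cast hp
    have hτc : (τ : ℂ) ^ 2 = 1 := by exact_mod_cast hτ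
    rw [← one_div, eq_div_iff hne]
    push_cast
    field_simp
    linear_combination (-(ε : ℂ) ^ 2 * τ ^ 2) * Complex.I_sq + (ε : ℂ) ^ 2 * hτc
  rw [intervalIntegral.integral_eq_sub_of_hasDerivAt hd]
  · rw [neg_div, arctan_neg, neg_sq]
    push_cast
    ring
  · refine Continuous.intervalIntegrable ?_ _ _
    exact (by fun_prop : Continuous fun u : ℝ => (u : ℂ) - Complex.I * (τ * ε : ℝ)).inv₀
      fun u => ofReal_sub_I_mul_ne_zero hε hτ u

lemma ae_ne_zero : ∀ᵐ u : ℝ, u ≠ 0 := compl_mem_ae_iff.2 (measure_singleton 0)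

namespace IsRegularCurve

variable {η : ℝ → ℂ} (hη : IsRegularCurve η)
include hη

/-- For small |u| the curve is nearly its tangent, from which the normal point is at distance
comparable to |u| + ε; for larger |u| the chord dominates once ε is small. -/
lemma exists_normal_bound {τ : ℝ} (hτ : τ ^ 2 = 1) (s : ℝ) :
    ∃ κ ε₀, 0 < κ ∧ 0 < ε₀ ∧ ∀ ε u, 0 < ε → ε < ε₀ → |u| ≤ π →
      κ * (|u| + ε) ≤ ‖η (s + u) - (η s + Complex.I * (τ * ε : ℝ) * deriv η s)‖ := by
  obtain ⟨K, hK, ht⟩ := hη.exists_taylor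
  obtain ⟨c, hc, hch⟩ := hη.exists_chord
  set a := ‖deriv η s‖ with ha
  have ha0 : 0 < a := norm_pos_iff.2 (hη.deriv_ne_zero s)
  have hτ' : |τ| = 1 := by
    rw [← sq_abs] at hτ
    nlinarith [abs_nonneg τ]
  set δ := a / (4 * K) with hδ
  have hδ0 : 0 < δ := by positivity
  refine ⟨min (a / 4) (c / 2), c * δ / (4 * a), by positivity, by positivity,
    fun ε u hε hε' hu => ?_⟩
  rw [lt_div_iff₀ (by positivity)] at hε'
  rcases le_total |u| δ with h | h
  · have h1 : a * ((|u| + ε) / 2) ≤ ‖((u : ℂ) - Complex.I * (τ * ε : ℝ)) * deriv η s‖ := by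
      rw [norm_mul, mul_comm]
      gcongr
      exact half_le_norm_ofReal_sub hε hτ u
    have h2 : ‖((u : ℂ) - Complex.I * (τ * ε : ℝ)) * deriv η s‖ ≤
        ‖η (s + u) - (η s + Complex.I * (τ * ε : ℝ) * deriv η s)‖ + K * |u| ^ 2 := by
      calc _ = ‖(η (s + u) - (η s + Complex.I * (τ * ε : ℝ) * deriv η s)) -
            (η (s + u) - η s - u * deriv η s)‖ := by congr 1; ring
        _ ≤ _ := (norm_sub_le _ _).trans (by gcongr; exact ht s u)
    have h3 : K * |u| ^ 2 ≤ a / 4 * |u| := by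
      have : K * |u| ≤ a / 4 := by
        calc K * |u| ≤ K * δ := by gcongr
          _ = a / 4 := by rw [hδ]; field_simp
      nlinarith [abs_nonneg u]
    have h4 : min (a / 4) (c / 2) * (|u| + ε) ≤ a / 4 * (|u| + ε) := by
      gcongr; exact min_le_left _ _
    nlinarith
  · have h1 : c * |u| ≤ ‖η (s + u) - (η s + Complex.I * (τ * ε : ℝ) * deriv η s)‖ + ε * a := by
      calc _ ≤ ‖η (s + u) - η s‖ := hch s u hu
        _ = ‖(η (s + u) - (η s + Complex.I * (τ * ε : ℝ) * deriv η s)) +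
            Complex.I * (τ * ε : ℝ) * deriv η s‖ := by congr 1; ring
        _ ≤ _ := by
          refine (norm_add_le _ _).trans ?_
          gcongr
          simp [hτ', abs_of_pos hε, ha]
    have h2 : c * δ ≤ c * |u| := by gcongr
    have h3 : min (a / 4) (c / 2) * |u| ≤ c / 2 * |u| := by gcongr; exact min_le_right _ _
    have h4 : min (a / 4) (c / 2) * ε ≤ a / 4 * ε := by gcongr; exact min_le_left _ _
    nlinarith

lemma normal_notMem_range {τ : ℝ} (hτ : τ ^ 2 = 1) (s : ℝ) :
    ∀ᶠ ε in 𝓝[>] (0 : ℝ), η s + Complex.I * (τ * ε : ℝ) * deriv η s ∉ range η := by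
  obtain ⟨κ, ε₀, hκ, hε₀, hb⟩ := hη.exists_normal_bound hτ s
  filter_upwards [Ioo_mem_nhdsGT hε₀] with ε hε
  rintro ⟨t, ht⟩
  obtain ⟨y, hy, h⟩ := hη.periodic.exists_mem_Ico two_pi_pos t (s - π)
  have := hb ε (y - s) hε.1 hε.2 (abs_le.2 ⟨by linarith [hy.1], by linarith [hy.2]⟩)
  rw [add_sub_cancel, ← h, ht, sub_self, norm_zero] at this
  have h1 : 0 < κ * (|y - s| + ε) := mul_pos hκ (by linarith [abs_nonneg (y - s), hε.1])
  linarith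

/-- Subtracting the model kernel 1/(u - iτε) leaves an integrand bounded uniformly in ε, so its
integral converges to `pvCauchy`; the model itself contributes 2iτ arctan(π/ε), which tends to iτπ.
-/
lemma tendsto_winding_integral_normal {τ : ℝ} (hτ : τ ^ 2 = 1) (s : ℝ) :
    Tendsto (fun ε : ℝ => cauchyTerm η (fun _ => 1) (η s + Complex.I * (τ * ε : ℝ) * deriv η s))
      (𝓝[>] 0) (𝓝 (pvCauchy η s + Complex.I * τ * π)) := by
  obtain ⟨κ, ε₀, hκ, hε₀, hb⟩ := hη.exists_normal_bound hτ s
  obtain ⟨K, hK, ht⟩ := hη.exists_taylor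
  obtain ⟨L, hL, -, hl⟩ := exists_lipschitz_of_periodic hη.contDiff_deriv
    (periodic_deriv hη.periodic)
  have hτ' : |τ| = 1 := by
    rw [← sq_abs] at hτ
    nlinarith [abs_nonneg τ]
  set z : ℝ → ℂ := fun ε => η s + Complex.I * (τ * ε : ℝ) * deriv η s with hz
  have hgood : ∀ᶠ ε in 𝓝[>] (0 : ℝ), 0 < ε ∧ ε < ε₀ ∧ z ε ∉ range η := by
    filter_upwards [Ioo_mem_nhdsGT hε₀, hη.normal_notMem_range hτ s] with ε h1 h2
    exact ⟨h1.1, h1.2, h2⟩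
  have hc1 : ∀ ε, 0 < ε → Continuous fun u : ℝ => ((u : ℂ) - Complex.I * (τ * ε : ℝ))⁻¹ :=
    fun ε hε => (by fun_prop : Continuous fun u : ℝ => (u : ℂ) - Complex.I * (τ * ε : ℝ)).inv₀
      fun u => ofReal_sub_I_mul_ne_zero hε hτ u
  have hc2 : ∀ ε, z ε ∉ range η → Continuous fun u : ℝ => deriv η (s + u) / (η (s + u) - z ε) :=
    fun ε hε => by
      simpa [Function.comp_def] using ((hη.continuous_cauchy_integrand (ψ := fun _ => 1) continuous_const hε).comp
        (continuous_const.add continuous_id : Continuous fun u : ℝ => s + u))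
  have hsplit : ∀ᶠ ε in 𝓝[>] (0 : ℝ), (∫ u in (-π)..π, (deriv η (s + u) / (η (s + u) - z ε) -
      ((u : ℂ) - Complex.I * (τ * ε : ℝ))⁻¹)) + Complex.I * τ * (2 * arctan (π / ε) : ℝ) =
      cauchyTerm η (fun _ => 1) (z ε) := by
    filter_upwards [hgood] with ε hε
    rw [cauchyTerm, intervalIntegral_eq_symm_of_periodic
      (hη.periodic_cauchy_integrand (ψ := fun _ => 1) (fun _ => rfl) _) s,
      ← integral_inv_ofReal_sub hε.1 hτ, ← intervalIntegral.integral_add]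
    · simp
    · exact ((hc2 ε hε.2.2).sub (hc1 ε hε.1)).intervalIntegrable _ _
    · exact (hc1 ε hε.1).intervalIntegrable _ _
  refine Tendsto.congr' hsplit (Tendsto.add ?_ ?_)
  · refine intervalIntegral.tendsto_integral_filter_of_dominated_convergence
      (fun _ => 2 * (L + K) / κ) ?_ ?_ (by simp) ?_
    · filter_upwards [hgood] with ε hε
      exact ((hc2 ε hε.2.2).sub (hc1 ε hε.1)).aestronglyMeasurable
    · filter_upwards [hgood] with ε hε
      refine ae_of_all _ fun u hu => ?_
      have hu' := abs_le_of_mem_uIoc_neg pi_pos.le hu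
      have e1 : η (s + u) - z ε ≠ 0 := fun h => hε.2.2 ⟨_, sub_eq_zero.1 h⟩
      have e2 := ofReal_sub_I_mul_ne_zero hε.1 hτ u
      -- The numerator is O((|u| + ε)²) and the denominator is at least κ(|u| + ε)²/2, which gives
      -- the dominating constant 2(L + K)/κ.
      have e : deriv η (s + u) / (η (s + u) - z ε) - ((u : ℂ) - Complex.I * (τ * ε : ℝ))⁻¹ =
          (((u : ℂ) - Complex.I * (τ * ε : ℝ)) * (deriv η (s + u) - deriv η s) -
            (η (s + u) - η s - u * deriv η s)) /
          ((η (s + u) - z ε) * ((u : ℂ) - Complex.I * (τ * ε : ℝ))) := by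
        rw [← one_div, div_sub_div _ _ e1 e2]
        congr 1
        simp only [hz]
        ring
      have hp : 0 < |u| + ε := by linarith [abs_nonneg u, hε.1]
      have hn : ‖(u : ℂ) - Complex.I * (τ * ε : ℝ)‖ ≤ |u| + ε := by
        refine (norm_sub_le _ _).trans ?_
        simp [hτ', abs_of_pos hε.1]
      rw [e, norm_div, norm_mul]
      calc _ ≤ ((|u| + ε) * (L * (|u| + ε)) + K * (|u| + ε) ^ 2) /
            ((κ * (|u| + ε)) * ((|u| + ε) / 2)) := by
            have hu1 : |u| ≤ |u| + ε := by linarith [hε.1]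
            gcongr
            · refine (norm_sub_le _ _).trans ?_
              rw [norm_mul]
              gcongr
              · have := hl (s + u) s
                rw [add_sub_cancel_left] at this
                exact this.trans (by gcongr)
              · exact (ht s u).trans (by gcongr)
            · exact hb ε u hε.1 hε.2.1 hu'
            · exact half_le_norm_ofReal_sub hε.1 hτ u
        _ = _ := by field_simp
    · filter_upwards [ae_ne_zero] with u h0 hu
      have hu' := abs_le_of_mem_uIoc_neg pi_pos.le hu
      have h0' : (u : ℂ) ≠ 0 := by exact_mod_cast h0
      have hcont : ContinuousAt (fun ε : ℝ => deriv η (s + u) / (η (s + u) - z ε) -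
          ((u : ℂ) - Complex.I * (τ * ε : ℝ))⁻¹) 0 := by
        refine ContinuousAt.sub (ContinuousAt.div continuousAt_const ?_ ?_)
          (ContinuousAt.inv₀ ?_ ?_)
        · exact (by fun_prop : Continuous fun ε : ℝ => η (s + u) - z ε).continuousAt
        · simpa [hz] using hη.sub_ne_zero (s := s) hu' h0
        · exact (by fun_prop : Continuous fun ε : ℝ =>
            (u : ℂ) - Complex.I * (τ * ε : ℝ)).continuousAt
        · simpa using h0'
      have := hcont.tendsto.mono_left (nhdsWithin_le_nhds (s := Ioi 0))
      simpa [hz, chordKernel] using this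
  · have h1 : Tendsto (fun ε : ℝ => 2 * arctan (π / ε)) (𝓝[>] 0) (𝓝 π) := by
      have h2 : Tendsto (fun ε : ℝ => π / ε) (𝓝[>] 0) atTop := by
        simpa [div_eq_mul_inv] using tendsto_inv_nhdsGT_zero.const_mul_atTop pi_pos
      have := ((tendsto_arctan_atTop.mono_right nhdsWithin_le_nhds).comp h2).const_mul 2
      simpa [mul_div_cancel₀] using this
    exact ((Complex.continuous_ofReal.tendsto _).comp h1).const_mul _

/-- The Cauchy principal value is determined by the winding numbers on the two sides of the
curve. -/
lemma pvCauchy_eq {s : ℝ} (h : ∀ᶠ z in 𝓝 (η s), z ∉ range η →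
    cauchyTerm η (fun _ => 1) z = 0 ∨ cauchyTerm η (fun _ => 1) z = -(2 * π * Complex.I)) :
    pvCauchy η s = -(π * Complex.I) := by
  -- Both pv + iπ and pv - iπ lie in {0, -2πi}; only pv = -πi satisfies this, so it need not be
  -- known which side of the curve each normal points to.
  have key : ∀ τ : ℝ, τ ^ 2 = 1 → pvCauchy η s + Complex.I * τ * π ∈
      ({0, -(2 * π * Complex.I)} : Set ℂ) := fun τ hτ => by
    refine ((Set.toFinite _).isClosed).mem_of_tendsto (hη.tendsto_winding_integral_normal hτ s) ?_
    have hlim : Tendsto (fun ε : ℝ => η s + Complex.I * (τ * ε : ℝ) * deriv η s) (𝓝[>] 0)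
        (𝓝 (η s)) := by
      have : Continuous fun ε : ℝ => η s + Complex.I * (τ * ε : ℝ) * deriv η s := by fun_prop
      simpa using (this.tendsto 0).mono_left nhdsWithin_le_nhds
    filter_upwards [hlim.eventually h, hη.normal_notMem_range hτ s] with ε h1 h2
    exact h1 h2
  have h1 := key 1 (by norm_num)
  have h2 := key (-1) (by norm_num)
  have hpi : (π : ℂ) * Complex.I ≠ 0 := by simp [pi_ne_zero]
  simp only [Set.mem_insert_iff, Set.mem_singleton_iff, Complex.ofReal_one, mul_one,
    Complex.ofReal_neg] at h1 h2
  rcases h1 with h1 | h1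
  · linear_combination h1
  · rcases h2 with h2 | h2
    · exact absurd (by linear_combination (h1 - h2) / 4 : (π : ℂ) * Complex.I = 0) hpi
    · linear_combination h2

end IsRegularCurve

/-! ### Symmetric truncation and densities on the boundary -/

lemma intervalIntegrable_inv_of_pos {a b : ℝ} (ha : 0 < a) (hb : 0 < b) :
    IntervalIntegrable (fun u : ℝ => u⁻¹) volume a b :=
  intervalIntegral.intervalIntegrable_inv (f := id)
    (fun x hx => by
      have := (lt_min ha hb).trans_le hx.1
      exact this.ne') continuousOn_id

lemma intervalIntegrable_inv_of_neg {a b : ℝ} (ha : a < 0) (hb : b < 0) :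
    IntervalIntegrable (fun u : ℝ => u⁻¹) volume a b :=
  intervalIntegral.intervalIntegrable_inv (f := id)
    (fun x hx => by
      have := hx.2.trans_lt (max_lt ha hb)
      exact this.ne) continuousOn_id

/-- A symmetric principal value of a periodic function with a simple pole. -/
lemma tendsto_integral_truncated {f g : ℝ → ℝ} (hf : Function.Periodic f (2 * π)) {s b : ℝ}
    (hg : IntervalIntegrable g volume (-π) π)
    (h : ∀ u, f (s + u) = g u + b * u⁻¹) :
    Tendsto (fun ε => ∫ t in (s + ε)..(s + 2 * π - ε), f t) (𝓝[>] 0)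
      (𝓝 (∫ u in (-π)..π, g u)) := by
  have hpi := pi_pos
  have hsub : ∀ {a b : ℝ}, -π ≤ a → a ≤ π → -π ≤ b → b ≤ π → IntervalIntegrable g volume a b :=
    fun ha ha' hb hb' => hg.mono_set (by
      rw [uIcc_of_le (by linarith : -π ≤ π)]
      exact uIcc_subset_Icc ⟨ha, ha'⟩ ⟨hb, hb'⟩)
  -- The truncated period is cut at s + π and its second half shifted back by 2π. The domain becomes
  -- symmetric about s, and the odd term b/u cancels.
  have key : ∀ᶠ ε in 𝓝[>] (0 : ℝ), (∫ u in (-π)..(-ε), g u) + ∫ u in ε..π, g u =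
      ∫ t in (s + ε)..(s + 2 * π - ε), f t := by
    filter_upwards [Ioo_mem_nhdsGT hpi] with ε hε
    obtain ⟨hε0, hεπ⟩ := hε
    have j1 : IntervalIntegrable g volume (-π) (-ε) :=
      hsub le_rfl (by linarith) (by linarith) (by linarith)
    have j2 : IntervalIntegrable g volume ε π :=
      hsub (by linarith) (by linarith) (by linarith) le_rfl
    have k1 := (intervalIntegrable_inv_of_neg (a := -π) (b := -ε) (by linarith)
      (by linarith)).const_mul b
    have k2 := (intervalIntegrable_inv_of_pos hε0 hpi).const_mul b
    have f1 : IntervalIntegrable (fun u => f (s + u)) volume (-π) (-ε) := by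
      simp only [h]; exact j1.add k1
    have f2 : IntervalIntegrable (fun u => f (s + u)) volume ε π := by
      simp only [h]; exact j2.add k2
    have f1' : IntervalIntegrable f volume (s + π) (s + 2 * π - ε) := by
      have hfe : (fun u => f (s + u)) = fun u => f (s + 2 * π + u) := by
        ext u
        rw [show s + 2 * π + u = s + u + 2 * π by ring, hf]
      rw [hfe] at f1
      have := f1.comp_add_left (-(s + 2 * π))
      simp only [add_neg_cancel_left] at this
      convert this using 1 <;> ring
    have f2' : IntervalIntegrable f volume (s + ε) (s + π) := by
      have := f2.comp_add_left (-s)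
      simp only [add_neg_cancel_left] at this
      convert this using 1 <;> ring
    rw [← intervalIntegral.integral_add_adjacent_intervals f2' f1']
    have e1 : ∫ t in (s + π)..(s + 2 * π - ε), f t = ∫ u in (-π)..(-ε), f (s + u) := by
      have : ∫ u in (-π)..(-ε), f (s + u) = ∫ u in (-π)..(-ε), f (s + 2 * π + u) := by
        congr 1
        ext u
        rw [show s + 2 * π + u = s + u + 2 * π by ring, hf]
      rw [this, intervalIntegral.integral_comp_add_left f (s + 2 * π)]
      congr 1
      ring
    have e2 : ∫ t in (s + ε)..(s + π), f t = ∫ u in ε..π, f (s + u) := by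
      rw [intervalIntegral.integral_comp_add_left f s]
    have e3 : ∫ u in (-π)..(-ε), u⁻¹ = -∫ u in ε..π, (u : ℝ)⁻¹ := by
      have := intervalIntegral.integral_comp_neg (a := ε) (b := π) fun u : ℝ => u⁻¹
      rw [← this, ← intervalIntegral.integral_neg]
      congr 1
      ext u
      rw [inv_neg]
    rw [e1, e2]
    simp only [h]
    rw [intervalIntegral.integral_add j1 k1, intervalIntegral.integral_add j2 k2,
      intervalIntegral.integral_const_mul, intervalIntegral.integral_const_mul, e3]
    ring
  refine Tendsto.congr' key ?_
  have hg0 : IntervalIntegrable g volume (-π) 0 := hsub le_rfl (by linarith) (by linarith) hpi.le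
  have hg1 : IntervalIntegrable g volume 0 π := hsub (by linarith) hpi.le (by linarith) le_rfl
  rw [← intervalIntegral.integral_add_adjacent_intervals hg0 hg1]
  have hc : ContinuousOn (fun x => ∫ u in (-π)..x, g u) (uIcc (-π) π) :=
    intervalIntegral.continuousOn_primitive_interval
      ((intervalIntegrable_iff' (μ := volume)).1 hg)
  rw [uIcc_of_le (by linarith)] at hc
  have hc0 : ContinuousAt (fun x => ∫ u in (-π)..x, g u) 0 :=
    hc.continuousAt (Icc_mem_nhds (by linarith) hpi)
  have hid : Tendsto (fun ε : ℝ => ε) (𝓝[>] 0) (𝓝 0) := nhdsWithin_le_nhds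
  have hneg : Tendsto (fun ε : ℝ => -ε) (𝓝[>] 0) (𝓝 0) := by simpa using hid.neg
  refine (hc0.tendsto.comp hneg).add ?_
  have e : ∀ᶠ ε in 𝓝[>] (0 : ℝ), (∫ u in (-π)..π, g u) - ∫ u in (-π)..ε, g u =
      ∫ u in ε..π, g u := by
    filter_upwards [Ioo_mem_nhdsGT hpi] with ε hε
    rw [intervalIntegral.integral_interval_sub_left hg
      (hsub le_rfl (by linarith) (by linarith [hε.1]) hε.2.le)]
  refine Tendsto.congr' e ?_
  have := (hc0.tendsto.comp hid).const_sub (∫ u in (-π)..π, g u)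
  rwa [intervalIntegral.integral_interval_sub_left hg hg0] at this

/-- Families of periodic Hölder continuous densities on the boundary curves. -/
def IsDensity {m : ℕ} (ψ : Fin m → ℝ → ℂ) : Prop :=
  ∀ k, Function.Periodic (ψ k) (2 * π) ∧ ∃ α, 0 < α ∧ α ≤ 1 ∧ BddHolder α (ψ k)

lemma IsDensity.continuous {m : ℕ} {ψ : Fin m → ℝ → ℂ} (h : IsDensity ψ) (k : Fin m) :
    Continuous (ψ k) := by
  obtain ⟨-, α, h0, -, hα⟩ := h k
  exact hα.continuous h0

lemma IsCoefficient.bddHolder {m : ℕ} {A : Fin m → ℝ → ℂ} (hA : IsCoefficient A) (k : Fin m) :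
    BddHolder 1 (A k) := .of_contDiff (hA.contDiff k) (hA.periodic k)

lemma IsCoefficient.bddHolder_inv {m : ℕ} {A : Fin m → ℝ → ℂ} (hA : IsCoefficient A)
    (k : Fin m) : BddHolder 1 (fun s => (A k s)⁻¹) :=
  .of_contDiff ((hA.contDiff k).inv (hA.ne_zero k)) fun s => by rw [hA.periodic k]

lemma IsDensity.div {m : ℕ} {A : Fin m → ℝ → ℂ} (hA : IsCoefficient A) {φ : Fin m → ℝ → ℝ}
    (hφ : φ ∈ H m) : IsDensity (fun k s => (φ k s : ℂ) / A k s) := fun k => by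
  obtain ⟨hp, C, α, h0, h1, hα⟩ := hφ k
  refine ⟨fun s => by simp only; rw [hp, hA.periodic k], α, h0, h1, ?_⟩
  simp only [div_eq_mul_inv]
  exact (BddHolder.ofReal h0 hα hp).mul
    ((hA.bddHolder_inv k).mono α.2 (by exact_mod_cast h1))

lemma IsDensity.add_mul {m : ℕ} {ψ χ : Fin m → ℝ → ℂ} (hψ : IsDensity ψ) (hχ : IsDensity χ)
    (c : ℂ) : IsDensity (fun k s => ψ k s + c * χ k s) := fun k => by
  obtain ⟨hp, α, h0, h1, hα⟩ := hψ k
  obtain ⟨hq, β, g0, g1, hβ⟩ := hχ k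
  have hm : 0 < min α β := lt_min h0 g0
  exact ⟨fun s => by simp only; rw [hp, hq], min α β, hm, (min_le_left _ _).trans h1,
    (hα.mono hm.le (min_le_left _ _)).add
      ((BddHolder.const c).mul (hβ.mono hm.le (min_le_right _ _)))⟩

/-! ### Local geometry of the region and direct boundary values -/

namespace UnboundedRegion

variable {m : ℕ} (R : UnboundedRegion m)

lemma isRegularCurve (k : Fin m) : IsRegularCurve (R.η k) :=
  ⟨R.contDiff_η k, R.periodic_η k, R.deriv_η_ne_zero k, R.injOn_η k⟩

lemma disjoint_G_range (k : Fin m) : Disjoint R.G (range (R.η k)) := by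
  have := disjoint_frontier_iff_isOpen.2 R.isOpen_G
  rw [R.frontier_G] at this
  exact (this.mono_left (subset_iUnion (fun k => range (R.η k)) k)).symm

lemma disjoint_hole_range (j k : Fin m) : Disjoint (R.hole j) (range (R.η k)) := by
  rw [Set.disjoint_left]
  intro z hz hk
  have : z ∈ (R.G ∪ ⋃ k, range (R.η k))ᶜ := by
    rw [R.compl_eq_holes]; exact mem_iUnion.2 ⟨j, hz⟩
  exact this (Or.inr (mem_iUnion.2 ⟨k, hk⟩))

lemma ne_of_ne {j k : Fin m} (h : j ≠ k) (t s : ℝ) : R.η j t ≠ R.η k s := fun e =>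
  Set.disjoint_left.1 (R.disjoint_curves j k h) ⟨t, rfl⟩ ⟨s, e.symm⟩

lemma notMem_range {j k : Fin m} (h : j ≠ k) (s : ℝ) : R.η k s ∉ range (R.η j) := fun ⟨t, e⟩ =>
  R.ne_of_ne h t s e

lemma GMinus_eq : R.GMinus = ⋃ k, R.hole k := R.compl_eq_holes

lemma winding_integral_G (k : Fin m) {z : ℂ} (hz : z ∈ R.G) :
    cauchyTerm (R.η k) (fun _ => 1) z = 0 :=
  (R.isRegularCurve k).winding_integral_eq_zero R.isOpen_G R.isConnected_G.isPreconnected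
    R.isBounded_compl_G (R.disjoint_G_range k) hz

lemma winding_integral_hole (k : Fin m) {z : ℂ} (hz : z ∈ R.hole k) :
    cauchyTerm (R.η k) (fun _ => 1) z = -(2 * π * Complex.I) := by
  have h := R.clockwise k z hz
  have hne : (2 * (π : ℂ) * Complex.I) ≠ 0 := by simp [pi_ne_zero]
  rw [windingNumber, inv_mul_eq_iff_eq_mul₀ hne] at h
  simp only [cauchyTerm, one_mul]
  rw [h]
  ring

lemma eventually_notMem_hole {j k : Fin m} (h : j ≠ k) (s : ℝ) :
    ∀ᶠ z in 𝓝 (R.η k s), z ∉ R.hole j := by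
  have : R.η k s ∉ closure (R.hole j) := by
    rw [closure_eq_self_union_frontier, R.frontier_hole]
    rintro (h1 | h1)
    · exact Set.disjoint_left.1 (R.disjoint_hole_range j k) h1 ⟨s, rfl⟩
    · exact R.notMem_range h s h1
  filter_upwards [isClosed_closure.isOpen_compl.mem_nhds this] with z hz h1
  exact hz (subset_closure h1)

/-- The other curves and the closures of the other holes are closed and miss the point, so near it
only G, the curve k and its own hole remain. -/
lemma eventually_mem (k : Fin m) (s : ℝ) :
    ∀ᶠ z in 𝓝 (R.η k s), z ∈ R.G ∨ z ∈ range (R.η k) ∨ z ∈ R.hole k := by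
  have h1 : ∀ᶠ z in 𝓝 (R.η k s), ∀ j, j ≠ k → z ∉ R.hole j ∧ z ∉ range (R.η j) := by
    rw [eventually_all]
    intro j
    by_cases h : j = k
    · simp [h]
    · filter_upwards [R.eventually_notMem_hole h s,
        (R.isRegularCurve j).isClosed_range.isOpen_compl.mem_nhds (R.notMem_range h s)]
        with z h1 h2 _ using ⟨h1, h2⟩
  filter_upwards [h1] with z hz
  by_cases hG : z ∈ R.G ∪ ⋃ k, range (R.η k)
  · rcases hG with hG | hG
    · exact Or.inl hG
    · obtain ⟨j, hj⟩ := mem_iUnion.1 hG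
      by_cases h : j = k
      · exact Or.inr (Or.inl (h ▸ hj))
      · exact absurd hj (hz j h).2
  · have : z ∈ ⋃ k, R.hole k := R.compl_eq_holes ▸ hG
    obtain ⟨j, hj⟩ := mem_iUnion.1 this
    by_cases h : j = k
    · exact Or.inr (Or.inr (h ▸ hj))
    · exact absurd hj (hz j h).1

lemma pvCauchy_eq (k : Fin m) (s : ℝ) : pvCauchy (R.η k) s = -(π * Complex.I) := by
  refine (R.isRegularCurve k).pvCauchy_eq ?_
  filter_upwards [R.eventually_mem k s] with z hz hn
  rcases hz with h | h | h
  · exact Or.inl (R.winding_integral_G k h)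
  · exact absurd h hn
  · exact Or.inr (R.winding_integral_hole k h)

/-- The direct value of the Cauchy integral on the boundary, without the factor `1 / (2πi)` and
the term that comes from the constant density. -/
def boundaryCauchy (ψ : Fin m → ℝ → ℂ) (k : Fin m) (s : ℝ) : ℂ :=
  regCauchy (R.η k) (ψ k) s + ∑ j ∈ Finset.univ.erase k, cauchyTerm (R.η j) (ψ j) (R.η k s)

lemma boundaryCauchy_add_mul {ψ χ : Fin m → ℝ → ℂ} (hψ : IsDensity ψ) (hχ : IsDensity χ) (c : ℂ)
    (k : Fin m) (s : ℝ) : R.boundaryCauchy (fun k s => ψ k s + c * χ k s) k s =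
      R.boundaryCauchy ψ k s + c * R.boundaryCauchy χ k s := by
  obtain ⟨-, α, h0, -, hα⟩ := hψ k
  obtain ⟨-, β, g0, -, hβ⟩ := hχ k
  have e1 : regCauchy (R.η k) (fun s => ψ k s + c * χ k s) s =
      regCauchy (R.η k) (ψ k) s + c * regCauchy (R.η k) (χ k) s := by
    simp only [regCauchy]
    rw [← intervalIntegral.integral_const_mul, ← intervalIntegral.integral_add
      ((R.isRegularCurve k).intervalIntegrable_regCauchy h0 hα s)
      (((R.isRegularCurve k).intervalIntegrable_regCauchy g0 hβ s).const_mul c)]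
    congr 1
    ext u
    ring
  have e2 : ∀ j ∈ Finset.univ.erase k, cauchyTerm (R.η j) (fun s => ψ j s + c * χ j s) (R.η k s) =
      cauchyTerm (R.η j) (ψ j) (R.η k s) + c * cauchyTerm (R.η j) (χ j) (R.η k s) := fun j hj => by
    have hn := R.notMem_range (Finset.ne_of_mem_erase hj) s
    simp only [cauchyTerm]
    rw [← intervalIntegral.integral_const_mul, ← intervalIntegral.integral_add
      (((R.isRegularCurve j).continuous_cauchy_integrand (hψ.continuous j)
        hn).intervalIntegrable _ _)
      ((((R.isRegularCurve j).continuous_cauchy_integrand (hχ.continuous j)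
        hn).intervalIntegrable _ _).const_mul c)]
    congr 1
    ext u
    ring
  rw [boundaryCauchy, boundaryCauchy, boundaryCauchy, e1, Finset.sum_congr rfl e2,
    Finset.sum_add_distrib, ← Finset.mul_sum]
  ring

/-- The other curves contribute analytic functions restricted to the curve k, hence periodic C¹
functions of s; only the regularized integral loses exponent. -/
lemma exists_bddHolder_boundaryCauchy {ψ : Fin m → ℝ → ℂ} (hψ : IsDensity ψ) (k : Fin m) :
    ∃ α, 0 < α ∧ α ≤ 1 ∧ BddHolder α (ψ k) ∧ BddHolder α (R.boundaryCauchy ψ k) := by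
  obtain ⟨-, α, h0, h1, hα⟩ := hψ k
  refine ⟨α / 2, by linarith, by linarith, hα.mono (by linarith) (by linarith), ?_⟩
  refine ((R.isRegularCurve k).bddHolder_regCauchy h0 h1 hα).add (BddHolder.sum _ fun j hj => ?_)
  refine BddHolder.mono (.of_contDiff ?_ fun s => ?_) (by linarith) (by linarith : α / 2 ≤ 1)
  · rw [contDiff_iff_contDiffAt]
    intro s
    have hn := R.notMem_range (Finset.ne_of_mem_erase hj) s
    have hd : DifferentiableOn ℂ (cauchyTerm (R.η j) (ψ j)) (range (R.η j))ᶜ := fun z hz =>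
      ((R.isRegularCurve j).hasDerivAt_cauchyTerm (hψ.continuous j)
        hz).differentiableAt.differentiableWithinAt
    have ho := (R.isRegularCurve j).isClosed_range.isOpen_compl
    have hc : ContDiffAt ℂ 1 (cauchyTerm (R.η j) (ψ j)) (R.η k s) :=
      (hd.contDiffOn ho).contDiffAt (ho.mem_nhds hn)
    exact (hc.restrict_scalars ℝ).comp s ((R.contDiff_η k).of_le (by norm_num)).contDiffAt
  · rw [R.periodic_η k]

/-! ### The operators -/

lemma kernel_mul_eq_of_ne (A : Fin m → ℝ → ℂ) (φ : Fin m → ℝ → ℝ) (k : Fin m) (s : ℝ) (j : Fin m) (t : ℝ) :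
    R.kernel A k s j t * φ j t = (1 / π) * A k s *
      (φ j t / A j t * (deriv (R.η j) t / (R.η j t - R.η k s))) := by
  rw [kernel]
  ring

lemma integral_kernel_of_ne (A : Fin m → ℝ → ℂ) (φ : Fin m → ℝ → ℝ) (j k : Fin m) (s : ℝ) :
    ∫ t in (0 : ℝ)..(2 * π), R.kernel A k s j t * φ j t =
      (1 / π) * A k s * cauchyTerm (R.η j) (fun s => φ j s / A j s) (R.η k s) := by
  simp only [R.kernel_mul_eq_of_ne A φ]
  rw [intervalIntegral.integral_const_mul, cauchyTerm]

variable {A : Fin m → ℝ → ℂ} (hA : IsCoefficient A) {φ : Fin m → ℝ → ℝ}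
include hA

/-- Isolates the pole as a real term in 1/u: it is invisible to the imaginary part, and odd in the
real part. The other terms are integrable. -/
lemma kernel_mul_eq (k : Fin m) (s u : ℝ) :
    R.kernel A k s k (s + u) * φ k (s + u) =
      (1 / π) * (A k s * ((φ k (s + u) / A k (s + u) - φ k s / A k s) * chordKernel (R.η k) s u) +
        φ k s * (chordKernel (R.η k) s u - (u : ℂ)⁻¹)) + ((φ k s / π * u⁻¹ : ℝ) : ℂ) := by
  have h1 := hA.ne_zero k s
  have h2 := hA.ne_zero k (s + u)
  rw [kernel, chordKernel]
  push_cast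
  generalize deriv (R.η k) (s + u) / (R.η k (s + u) - R.η k s) = J
  field_simp
  ring

lemma periodic_kernel (k : Fin m) (s : ℝ) (j : Fin m) :
    Function.Periodic (R.kernel A k s j) (2 * π) := fun t => by
  rw [kernel, kernel, hA.periodic j, periodic_deriv (R.periodic_η j), R.periodic_η j]

lemma periodic_kernelN (k : Fin m) (s : ℝ) (j : Fin m) :
    Function.Periodic (R.kernelN A k s j) (2 * π) := fun t => by
  rw [kernelN, kernelN, R.periodic_kernel hA, hA.periodic j, R.periodic_η j,
    periodic_deriv (R.periodic_η j), periodic_deriv (periodic_deriv (R.periodic_η j)),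
    periodic_deriv (hA.periodic j)]

variable (hφ : φ ∈ H m)
include hφ

lemma intervalIntegrable_kernel (k : Fin m) (s : ℝ) : IntervalIntegrable (fun u : ℝ =>
    (1 / (π : ℂ)) * (A k s * ((φ k (s + u) / A k (s + u) - φ k s / A k s) *
      chordKernel (R.η k) s u) + φ k s * (chordKernel (R.η k) s u - (u : ℂ)⁻¹)))
    volume (-π) π ∧ ∫ u in (-π)..π, (1 / (π : ℂ)) * (A k s *
      ((φ k (s + u) / A k (s + u) - φ k s / A k s) * chordKernel (R.η k) s u) +
        φ k s * (chordKernel (R.η k) s u - (u : ℂ)⁻¹)) =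
      (1 / π) * (A k s * regCauchy (R.η k) (fun s => φ k s / A k s) s -
        π * Complex.I * φ k s) := by
  obtain ⟨-, α, h0, -, hα⟩ := IsDensity.div hA hφ k
  have i1 := ((R.isRegularCurve k).intervalIntegrable_regCauchy h0 hα s).const_mul (A k s)
  have i2 : IntervalIntegrable (fun u : ℝ => chordKernel (R.η k) s u - (u : ℂ)⁻¹)
      volume (-π) π := by
    obtain ⟨C, hC, -, -, hb⟩ := (R.isRegularCurve k).exists_chordKernel_bounds
    refine (intervalIntegrable_const (c := C)).mono_fun' ?_ ?_
    · exact (((R.isRegularCurve k).measurable_chordKernel s).sub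
        (Complex.measurable_ofReal.inv)).aestronglyMeasurable
    · exact (ae_restrict_iff' measurableSet_uIoc).2 (ae_of_all _ fun u hu =>
        hb s u (abs_le_of_mem_uIoc_neg pi_pos.le hu))
  refine ⟨(i1.add (i2.const_mul _)).const_mul _, ?_⟩
  rw [intervalIntegral.integral_const_mul, intervalIntegral.integral_add i1 (i2.const_mul _),
    intervalIntegral.integral_const_mul, intervalIntegral.integral_const_mul]
  have := R.pvCauchy_eq k s
  rw [pvCauchy] at this
  rw [this, regCauchy]
  ring

lemma continuous_kernel_mul {j k : Fin m} (h : j ≠ k) (s : ℝ) :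
    Continuous (fun t => R.kernel A k s j t * φ j t) := by
  simp only [R.kernel_mul_eq_of_ne A φ]
  exact continuous_const.mul ((R.isRegularCurve j).continuous_cauchy_integrand
    ((IsDensity.div hA hφ).continuous j) (R.notMem_range h s))

/-- Together with `tendsto_truncM`, this exhibits N and M as imaginary and real part of the same
complex expression; the term -πi φ is the principal value of the Cauchy kernel. -/
lemma opN_eq (k : Fin m) (s : ℝ) : R.opN A φ k s = ((1 / π) * (A k s *
    R.boundaryCauchy (fun k s => φ k s / A k s) k s - π * Complex.I * φ k s)).im := by
  rw [opN, ← Finset.add_sum_erase _ _ (Finset.mem_univ k)]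
  have hdiag : ∫ t in (0 : ℝ)..(2 * π), R.kernelN A k s k t * φ k t = ((1 / π) * (A k s *
      regCauchy (R.η k) (fun s => φ k s / A k s) s - π * Complex.I * φ k s)).im := by
    obtain ⟨i1, e1⟩ := R.intervalIntegrable_kernel hA hφ k s
    have hp : Function.Periodic (fun t => R.kernelN A k s k t * φ k t) (2 * π) := fun t => by
      simp only
      rw [R.periodic_kernelN hA, (hφ k).1]
    have h1 := hp.intervalIntegral_add_eq 0 (s + -π)
    rw [zero_add, show s + -π + 2 * π = s + π by ring,
      ← intervalIntegral.integral_comp_add_left (fun t => R.kernelN A k s k t * φ k t) s] at h1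
    rw [h1, ← e1, ← Complex.imCLM_apply, ← Complex.imCLM.intervalIntegral_comp_comm i1]
    -- The prescribed diagonal value of N matters only at u = 0, a null set.
    refine intervalIntegral.integral_congr_ae ?_
    filter_upwards [ae_ne_zero] with u h0 hu
    have hne : R.η k (s + u) ≠ R.η k s := sub_ne_zero.1
      ((R.isRegularCurve k).sub_ne_zero (abs_le_of_mem_uIoc_neg pi_pos.le hu) h0)
    rw [kernelN, if_neg hne, ← Complex.im_mul_ofReal, R.kernel_mul_eq hA, Complex.imCLM_apply,
      Complex.add_im, Complex.ofReal_im, add_zero]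
  have hoff : ∀ j ∈ Finset.univ.erase k, ∫ t in (0 : ℝ)..(2 * π), R.kernelN A k s j t * φ j t =
      ((1 / π) * A k s * cauchyTerm (R.η j) (fun s => φ j s / A j s) (R.η k s)).im := fun j hj => by
    have hjk := Finset.ne_of_mem_erase hj
    rw [← R.integral_kernel_of_ne A φ, ← Complex.imCLM_apply,
      ← Complex.imCLM.intervalIntegral_comp_comm
        ((R.continuous_kernel_mul hA hφ hjk s).intervalIntegrable _ _)]
    congr 1
    ext t
    rw [kernelN, if_neg (R.ne_of_ne hjk t s), Complex.imCLM_apply, Complex.im_mul_ofReal]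
  rw [hdiag, Finset.sum_congr rfl hoff, ← Complex.im_sum, ← Complex.add_im, ← Finset.mul_sum,
    boundaryCauchy]
  congr 1
  ring

lemma tendsto_truncM (k : Fin m) (s : ℝ) : Tendsto (fun ε => R.truncM A φ k s ε) (𝓝[>] 0)
    (𝓝 ((1 / π) * (A k s * R.boundaryCauchy (fun k s => φ k s / A k s) k s -
      π * Complex.I * φ k s)).re) := by
  have hdiag : Tendsto (fun ε => ∫ t in (s + ε)..(s + 2 * π - ε), R.kernelM A k s k t * φ k t)
      (𝓝[>] 0) (𝓝 ((1 / π) * (A k s * regCauchy (R.η k) (fun s => φ k s / A k s) s -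
        π * Complex.I * φ k s)).re) := by
    obtain ⟨i1, e1⟩ := R.intervalIntegrable_kernel hA hφ k s
    have hp : Function.Periodic (fun t => R.kernelM A k s k t * φ k t) (2 * π) := fun t => by
      simp only [kernelM]
      rw [R.periodic_kernel hA, (hφ k).1]
    rw [← e1, ← Complex.reCLM_apply, ← Complex.reCLM.intervalIntegral_comp_comm i1]
    refine tendsto_integral_truncated (b := φ k s / π) hp
      ⟨Complex.reCLM.integrable_comp i1.1, Complex.reCLM.integrable_comp i1.2⟩ fun u => ?_
    rw [kernelM, ← Complex.re_mul_ofReal, R.kernel_mul_eq hA, Complex.reCLM_apply,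
      Complex.add_re, Complex.ofReal_re]
  have hoff : ∀ j ∈ Finset.univ.erase k, ∫ t in (0 : ℝ)..(2 * π), R.kernelM A k s j t * φ j t =
      ((1 / π) * A k s * cauchyTerm (R.η j) (fun s => φ j s / A j s) (R.η k s)).re := fun j hj => by
    have hjk := Finset.ne_of_mem_erase hj
    rw [← R.integral_kernel_of_ne A φ, ← Complex.reCLM_apply,
      ← Complex.reCLM.intervalIntegral_comp_comm
        ((R.continuous_kernel_mul hA hφ hjk s).intervalIntegrable _ _)]
    congr 1
    ext t
    rw [kernelM, Complex.reCLM_apply, Complex.re_mul_ofReal]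
  have e : ∀ ε, R.truncM A φ k s ε = (∫ t in (s + ε)..(s + 2 * π - ε), R.kernelM A k s k t * φ k t) +
      ∑ j ∈ Finset.univ.erase k,
        ((1 / π) * A k s * cauchyTerm (R.η j) (fun s => φ j s / A j s) (R.η k s)).re := fun ε => by
    rw [truncM, ← Finset.add_sum_erase _ _ (Finset.mem_univ k), if_pos rfl]
    congr 1
    refine Finset.sum_congr rfl fun j hj => ?_
    rw [if_neg (Finset.ne_of_mem_erase hj), hoff j hj]
  simp only [e]
  rw [boundaryCauchy, mul_add, add_sub_right_comm, mul_add, Complex.add_re, Finset.mul_sum,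
    Finset.mul_sum, Complex.re_sum]
  simpa only [mul_assoc] using hdiag.add_const _

end UnboundedRegion

namespace UnboundedRegion

variable {m : ℕ} (R : UnboundedRegion m)

/-! ### Boundary values of the Cauchy integral -/

lemma tendsto_sum_cauchyTerm {ψ : Fin m → ℝ → ℂ} (hψ : IsDensity ψ) {S : Set ℂ} {k : Fin m}
    {s : ℝ} {w : ℂ} (hS : ∀ᶠ z in 𝓝[S] (R.η k s),
      z ∉ range (R.η k) ∧ cauchyTerm (R.η k) (fun _ => 1) z = w) :
    Tendsto (fun z => ∑ j, cauchyTerm (R.η j) (ψ j) z) (𝓝[S] (R.η k s))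
      (𝓝 (R.boundaryCauchy ψ k s + ψ k s * w)) := by
  obtain ⟨hp, α, h0, h1, hα⟩ := hψ k
  simp only [← Finset.add_sum_erase _ _ (Finset.mem_univ k)]
  rw [boundaryCauchy, add_right_comm]
  refine ((R.isRegularCurve k).tendsto_cauchyTerm h0 h1 hα hp hS).add
    (tendsto_finsetSum _ fun j hj => ?_)
  have hn := R.notMem_range (Finset.ne_of_mem_erase hj) s
  exact ((R.isRegularCurve j).hasDerivAt_cauchyTerm (hψ.continuous j)
    hn).continuousAt.tendsto.mono_left nhdsWithin_le_nhds

lemma differentiableAt_sum_cauchyTerm {ψ : Fin m → ℝ → ℂ} (hψ : IsDensity ψ) {z : ℂ}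
    (hz : z ∉ R.Γ) : DifferentiableAt ℂ (fun z => ∑ j, cauchyTerm (R.η j) (ψ j) z) z :=
  DifferentiableAt.fun_sum fun j _ => ((R.isRegularCurve j).hasDerivAt_cauchyTerm
    (hψ.continuous j) fun h => hz (mem_iUnion.2 ⟨j, h⟩)).differentiableAt

lemma isOpen_GMinus : IsOpen R.GMinus := R.GMinus_eq ▸ isOpen_iUnion R.isOpen_hole

lemma notMem_Γ_of_mem_G {z : ℂ} (hz : z ∈ R.G) : z ∉ R.Γ := fun h => by
  obtain ⟨k, hk⟩ := mem_iUnion.1 h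
  exact Set.disjoint_left.1 (R.disjoint_G_range k) hz hk

lemma subset_closure_G : R.G ∪ R.Γ ⊆ closure R.G := by
  rw [closure_eq_self_union_frontier, R.frontier_G]
  exact subset_rfl

lemma subset_closure_GMinus : R.GMinus ∪ R.Γ ⊆ closure R.GMinus := by
  refine union_subset subset_closure (iUnion_subset fun k => ?_)
  rw [← R.frontier_hole k, R.GMinus_eq]
  exact frontier_subset_closure.trans (closure_mono (subset_iUnion R.hole k))

variable {ψ : Fin m → ℝ → ℂ} (hψ : IsDensity ψ)
include hψ

/-- The Plemelj formula for the exterior boundary values. -/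
lemma tendsto_cauchy_G (k : Fin m) (s : ℝ) :
    Tendsto (fun z => (2 * (π : ℂ) * Complex.I)⁻¹ * ∑ j, cauchyTerm (R.η j) (ψ j) z)
      (𝓝[R.G] (R.η k s)) (𝓝 ((2 * (π : ℂ) * Complex.I)⁻¹ * R.boundaryCauchy ψ k s)) := by
  have := (R.tendsto_sum_cauchyTerm hψ (S := R.G) (k := k) (s := s) (w := 0) (by
    filter_upwards [self_mem_nhdsWithin] with z hz
    exact ⟨Set.disjoint_left.1 (R.disjoint_G_range k) hz, R.winding_integral_G k hz⟩)).const_mul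
      (2 * (π : ℂ) * Complex.I)⁻¹
  simpa using this

/-- The Plemelj formula for the interior boundary values. -/
lemma tendsto_cauchy_GMinus (k : Fin m) (s : ℝ) :
    Tendsto (fun z => (2 * (π : ℂ) * Complex.I)⁻¹ * ∑ j, cauchyTerm (R.η j) (ψ j) z)
      (𝓝[R.GMinus] (R.η k s))
      (𝓝 ((2 * (π : ℂ) * Complex.I)⁻¹ * R.boundaryCauchy ψ k s - ψ k s)) := by
  have := (R.tendsto_sum_cauchyTerm hψ (S := R.GMinus) (k := k) (s := s)
    (w := -(2 * π * Complex.I)) (by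
    filter_upwards [self_mem_nhdsWithin, mem_nhdsWithin_of_mem_nhds (R.eventually_mem k s)]
      with z hz hz'
    have h1 : z ∉ range (R.η k) := fun h => hz (Or.inr (mem_iUnion.2 ⟨k, h⟩))
    rcases hz' with h | h | h
    · exact absurd (Or.inl h) hz
    · exact absurd h h1
    · exact ⟨h1, R.winding_integral_hole k h⟩)).const_mul (2 * (π : ℂ) * Complex.I)⁻¹
  have hne : (2 * (π : ℂ) * Complex.I) ≠ 0 := by simp [pi_ne_zero]
  convert this using 2
  field_simp
  ring

/-- Limits at all boundary points make the extension by limits continuous up to Γ; on U it agrees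
with the Cauchy integral, so analyticity persists. -/
lemma exists_extension {U : Set ℂ} {v : Fin m → ℝ → ℂ} (hU : IsOpen U) (hUΓ : ∀ z ∈ U, z ∉ R.Γ)
    (hcl : U ∪ R.Γ ⊆ closure U) (hv : ∀ k s, Tendsto
      (fun z => (2 * (π : ℂ) * Complex.I)⁻¹ * ∑ j, cauchyTerm (R.η j) (ψ j) z)
      (𝓝[U] (R.η k s)) (𝓝 (v k s))) :
    ∃ f : ℂ → ℂ, EqOn f (fun z => (2 * (π : ℂ) * Complex.I)⁻¹ *
        ∑ j, cauchyTerm (R.η j) (ψ j) z) U ∧ AnalyticOnNhd ℂ f U ∧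
      ContinuousOn f (U ∪ R.Γ) ∧ ∀ k s, f (R.η k s) = v k s := by
  set F : ℂ → ℂ := fun z => (2 * (π : ℂ) * Complex.I)⁻¹ * ∑ j, cauchyTerm (R.η j) (ψ j) z with hF
  have hd : DifferentiableOn ℂ F U := fun z hz =>
    ((R.differentiableAt_sum_cauchyTerm hψ (hUΓ z hz)).const_mul _).differentiableWithinAt
  have heq : EqOn (extendFrom U F) F U := fun z hz =>
    extendFrom_eq (subset_closure hz) (hd.continuousOn z hz)
  refine ⟨extendFrom U F, heq, (hd.congr heq).analyticOnNhd hU,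
    continuousOn_extendFrom hcl ?_, fun k s => extendFrom_eq
      (hcl (Or.inr (mem_iUnion.2 ⟨k, s, rfl⟩))) (hv k s)⟩
  rintro z (hz | hz)
  · exact ⟨_, hd.continuousOn z hz⟩
  · obtain ⟨k, s, rfl⟩ := mem_iUnion.1 hz
    exact ⟨_, hv k s⟩

lemma tendsto_cauchy_cocompact :
    Tendsto (fun z => (2 * (π : ℂ) * Complex.I)⁻¹ * ∑ j, cauchyTerm (R.η j) (ψ j) z)
      (cocompact ℂ) (𝓝 0) := by
  have := (tendsto_finsetSum (Finset.univ : Finset (Fin m)) fun j _ =>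
    (R.isRegularCurve j).tendsto_cauchyTerm_cocompact (hψ.continuous j)).const_mul
      (2 * (π : ℂ) * Complex.I)⁻¹
  simpa using this

omit hψ

lemma eventually_cocompact_mem_G : ∀ᶠ z in cocompact ℂ, z ∈ R.G := by
  rw [← Metric.cobounded_eq_cocompact]
  simpa using Bornology.isBounded_def.1 R.isBounded_compl_G

/-- The boundary values of the Cauchy integral of `(γ + iμ) / A` for a solution `μ` of the
integral equation. -/
lemma boundary_value_eq {A : Fin m → ℝ → ℂ} (hA : IsCoefficient A) {γ μ : Fin m → ℝ → ℝ}
    (hγ : γ ∈ H m) (hμ : μ ∈ H m) (hie : ∀ k s, μ k s - R.opN A μ k s = -R.opM A γ k s)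
    (k : Fin m) (s : ℝ) : A k s * ((2 * (π : ℂ) * Complex.I)⁻¹ * R.boundaryCauchy
      (fun k s => (γ k s : ℂ) / A k s + Complex.I * ((μ k s : ℂ) / A k s)) k s) =
      (γ k s : ℂ) + (R.hFun A γ μ k s : ℂ) + Complex.I * (μ k s : ℂ) := by
  have hM := fun φ (hφ : φ ∈ H m) => (R.tendsto_truncM hA hφ k s).limUnder_eq
  have hN := fun φ (hφ : φ ∈ H m) => R.opN_eq hA hφ k s
  have hMγ : R.opM A γ k s = _ := hM γ hγ
  have hMμ : R.opM A μ k s = _ := hM μ hμ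
  have h := hie k s
  rw [R.boundaryCauchy_add_mul (IsDensity.div hA hγ) (IsDensity.div hA hμ), hFun, hMμ, hN γ hγ]
  rw [hMγ, hN μ hμ] at h
  generalize hX : A k s * R.boundaryCauchy (fun k s => (γ k s : ℂ) / A k s) k s = X at *
  generalize hY : A k s * R.boundaryCauchy (fun k s => (μ k s : ℂ) / A k s) k s = Y at *
  -- Here Nγ = Im X/π - γ, Mγ = Re X/π, and likewise for μ with Y. Thus the real part of (Y -
  -- iX)/(2π) is (Mμ + Nγ + γ)/2 = γ + h, and its imaginary part is (Nμ + μ - Mγ)/2.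
  have e : A k s * ((2 * (π : ℂ) * Complex.I)⁻¹ *
      (R.boundaryCauchy (fun k s => (γ k s : ℂ) / A k s) k s +
        Complex.I * R.boundaryCauchy (fun k s => (μ k s : ℂ) / A k s) k s)) =
      ((1 / (2 * π) : ℝ) : ℂ) * (-Complex.I * X + Y) := by
    rw [← hX, ← hY]
    push_cast
    have hπ : (π : ℂ) ≠ 0 := by exact_mod_cast pi_ne_zero
    field_simp
    ring_nf
    rw [Complex.I_sq]
    ring
  rw [e]
  have hr : (1 / (π : ℂ)) = ((1 / π : ℝ) : ℂ) := by push_cast; rfl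
  rw [hr] at h ⊢
  have hπ := pi_ne_zero
  simp only [Complex.sub_re, Complex.sub_im, Complex.mul_re,
    Complex.mul_im, Complex.ofReal_re, Complex.ofReal_im, Complex.I_re,
    Complex.I_im] at h ⊢
  apply Complex.ext
  · simp only [Complex.add_re, Complex.mul_re, Complex.neg_re,
      Complex.neg_im, Complex.ofReal_re, Complex.ofReal_im, Complex.I_re, Complex.I_im]
    field_simp
    ring
  · simp only [Complex.add_im, Complex.mul_im, Complex.neg_re,
      Complex.neg_im, Complex.ofReal_re, Complex.ofReal_im, Complex.I_re, Complex.I_im]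
    field_simp at h ⊢
    linarith

end UnboundedRegion

end GenNeumann

end

theorem mainTheorem2 {m : ℕ} (R : GenNeumann.UnboundedRegion m) (A : Fin m → ℝ → ℂ)
    (hA : GenNeumann.IsCoefficient A) (γ μ : Fin m → ℝ → ℝ)
    (hγ : γ ∈ GenNeumann.H m) (hμ : μ ∈ GenNeumann.H m)
    (hie : ∀ k s, μ k s - R.opN A μ k s = -R.opM A γ k s) :
    -- the principal values that define `M γ` and `M μ` exist
    (∀ k s, Filter.Tendsto (fun ε => R.truncM A γ k s ε) (nhdsWithin 0 (Set.Ioi 0))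
      (nhds (R.opM A γ k s))) ∧
    (∀ k s, Filter.Tendsto (fun ε => R.truncM A μ k s ε) (nhdsWithin 0 (Set.Ioi 0))
      (nhds (R.opM A μ k s))) ∧
    -- `f := Φ` in `G`, extended continuously to the boundary by its boundary values
    (∃ f : ℂ → ℂ, Set.EqOn f (R.cauchyIntegral A γ μ) R.G ∧
      AnalyticOnNhd ℂ f R.G ∧ ContinuousOn f (R.G ∪ R.Γ) ∧
      Filter.Tendsto f (Filter.cocompact ℂ) (nhds 0) ∧
      ∀ k s, A k s * f (R.η k s) =
        (γ k s : ℂ) + (R.hFun A γ μ k s : ℂ) + Complex.I * (μ k s : ℂ)) ∧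
    R.hFun A γ μ ∈ R.SMinus A := by
  have hd : GenNeumann.IsDensity
      (fun k s => (γ k s : ℂ) / A k s + Complex.I * ((μ k s : ℂ) / A k s)) :=
    (GenNeumann.IsDensity.div hA hγ).add_mul (GenNeumann.IsDensity.div hA hμ) Complex.I
  set ψ : Fin m → ℝ → ℂ := fun k s => (γ k s : ℂ) / A k s + Complex.I * ((μ k s : ℂ) / A k s)
    with hψ
  have hbd := R.boundary_value_eq hA hγ hμ hie
  -- Subtracting Aψ = γ + iμ from A f⁺ = γ + h + iμ leaves h, while the jump makes the left side A
  -- times the boundary value from the holes.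
  have hh : ∀ k s, (R.hFun A γ μ k s : ℂ) = A k s *
      ((2 * (Real.pi : ℂ) * Complex.I)⁻¹ * R.boundaryCauchy ψ k s - ψ k s) := fun k s => by
    have h1 := hbd k s
    have h2 : A k s * ψ k s = γ k s + Complex.I * μ k s := by
      have := hA.ne_zero k s
      simp only [hψ]
      field_simp
    linear_combination -h1 + h2
  refine ⟨fun k s => tendsto_nhds_limUnder ⟨_, R.tendsto_truncM hA hγ k s⟩,
    fun k s => tendsto_nhds_limUnder ⟨_, R.tendsto_truncM hA hμ k s⟩, ?_, ?_⟩
  · obtain ⟨f, h1, h2, h3, h4⟩ := R.exists_extension hd R.isOpen_G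
      (fun z hz => R.notMem_Γ_of_mem_G hz) R.subset_closure_G (R.tendsto_cauchy_G hd)
    refine ⟨f, fun z hz => (h1 hz).trans ?_, h2, h3, ?_, fun k s => by rw [h4]; exact hbd k s⟩
    · simp only [GenNeumann.UnboundedRegion.cauchyIntegral, GenNeumann.cauchyTerm, hψ,
        add_div, mul_div_assoc]
    · refine (R.tendsto_cauchy_cocompact hd).congr' ?_
      filter_upwards [R.eventually_cocompact_mem_G] with z hz using (h1 hz).symm
  · obtain ⟨g, -, h2, h3, h4⟩ := R.exists_extension hd R.isOpen_GMinus
      (fun z hz h => hz (Or.inr h)) R.subset_closure_GMinus (R.tendsto_cauchy_GMinus hd)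
    have hg : ∀ k s, (R.hFun A γ μ k s : ℂ) = A k s * g (R.η k s) := fun k s => by
      rw [h4]; exact hh k s
    refine ⟨fun k => ⟨fun s => ?_, ?_⟩, g, h2, h3, hg⟩
    -- Periodicity of h is inherited from the representation A g(η).
    · rw [← Complex.ofReal_inj, hg, hg, hA.periodic k, R.periodic_η k]
    · obtain ⟨α, h0, h1, hα, hβ⟩ := R.exists_bddHolder_boundaryCauchy hd k
      have hb : GenNeumann.BddHolder α (fun s => (R.hFun A γ μ k s : ℂ)) := by
        simp only [hh]
        exact ((hA.bddHolder k).mono h0.le h1).mul (((GenNeumann.BddHolder.const _).mul hβ).sub hα)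
      obtain ⟨C, hC⟩ := hb.exists_holderWith h0.le
      exact ⟨C, α.toNNReal, Real.toNNReal_pos.2 h0, Real.toNNReal_le_one.2 h1, hC⟩
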